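/- Let $a,b\in\mathbb R$ with $b\neq 0$, put $T=2\pi/|b|$, and let $\alpha_1,\alpha_2,\alpha_3,\alpha_4:\mathbb R\to\mathbb R$ be odd and twice continuously differentiable. (i) Let $e\in\mathbb R$ and suppose that the right-hand side of the system $$\begin{aligned} \dot x&=(ax+by+xz)(1+\alpha_1(t))+x(a+z)\alpha_2(t)+y\alpha_3(t),\\ \dot y&=(-bx+ay+yz)(1+\alpha_1(t))+y(a+z)\alpha_2(t)-x\alpha_3(t),\\ \dot z&=(ez-x^2-y^2-z^2)(1+\alpha_1(t)+\alpha_2(t)) \end{aligned}\tag{A}$$ is $T$-periodic in $t$, that $a(a+e)<0$, and that $\int_0^{-2\pi/|b|}(b\alpha_1(s)+\alpha_3(s))\,ds=2\pi k$ for some $k\in\mathbb Z$. Put $\theta(t)=bt+\int_0^t(b\alpha_1(s)+\alpha_3(s))\,ds$. Then $$\chi(t)=\bigl(\sqrt{-a(a+e)}\,\sin\theta(t),\ \sqrt{-a(a+e)}\,\cos\theta(t),\ -a\bigr)$$ is a $T$-periodic solution of (A). If $2a+e<0$, then for every initial time $t_0$ it is orbitally asymptotically stable (solutions starting at time $t_0$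 close enough to the orbit $\{\chi(s):s\in\mathbb R\}$ exist on $[t_0,\infty)$, stay close to the orbit, and their distance to the orbit tends to $0$ as $t\to\infty$) and also stable in the sense of Lyapunov. If $2a+e>0$, then for every initial time $t_0$ it is unstable, both orbitally and in the sense of Lyapunov. (ii) Suppose that the right-hand side of the system $$\begin{aligned} \dot x&=(ax+by+xz)(1+\alpha_1(t))+x(a+z)\alpha_2(t)+y\alpha_3(t)-y(x^2+y^2)(4az+x^2+y^2+2z^2)\alpha_4(t),\\ \dot y&=(-bx+ay+yz)(1+\alpha_1(t))+y(a+z)\alpha_2(t)-x\alpha_3(t)+x(x^2+y^2)(4az+x^2+y^2+2z^2)\alpha_4(t),\\ \dot z&=-(2az+x^2+y^2+z^2)(1+\alpha_1(t)+\alpha_2(t)) \end{aligned}\tag{B}$$ is $T$-periodic in $t$ and that $\int_0^{-2\pi/|b|}(b\alpha_1(s)+\alpha_3(s)+a^4\alpha_4(s))\,ds=2\pi k$ for some $k\in\mathbb Z$. Put $\eta(t)=bt+\int_0^t(b\alpha_1(s)+\alpha_3(s)+a^4\alpha_4(s))\,ds$. Then $t\mapsto(a\sin\eta(t),\ a\cos\eta(t),\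 -a)$ is a $T$-periodic solution of (B). (The period $T$ need not be minimal.) -/

import Mathlib

open Real Set Filter Topology MeasureTheory

noncomputable section

/-- The phase space `ℝ³` with its Euclidean norm; `p 0, p 1, p 2` are `x, y, z`. -/
abbrev Phase : Type := EuclideanSpace ℝ (Fin 3)

/-- Right-hand side of the generalized Langford system (with `c = -b`, `d = a`) perturbed by three
scalar functions of time. -/
def langfordField (a b e : ℝ) (α₁ α₂ α₃ : ℝ → ℝ) (t : ℝ) (p : Phase) : Phase :=
  !₂[(a * p 0 + b * p 1 + p 0 * p 2) * (1 + α₁ t)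
        + p 0 * (a + p 2) * α₂ t + p 1 * α₃ t,
     (-b * p 0 + a * p 1 + p 1 * p 2) * (1 + α₁ t)
        + p 1 * (a + p 2) * α₂ t - p 0 * α₃ t,
     (e * p 2 - p 0 ^ 2 - p 1 ^ 2 - p 2 ^ 2) * (1 + α₁ t + α₂ t)]

/-- Right-hand side of the generalized Langford system (with `c = -b`, `d = a`, `e = -2a`) perturbed
by four scalar functions of time. -/
def langfordField' (a b : ℝ) (α₁ α₂ α₃ α₄ : ℝ → ℝ) (t : ℝ) (p : Phase) : Phase :=
  !₂[(a * p 0 + b * p 1 + p 0 * p 2) * (1 + α₁ t)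
        + p 0 * (a + p 2) * α₂ t + p 1 * α₃ t
        - p 1 * (p 0 ^ 2 + p 1 ^ 2) * (4 * a * p 2 + p 0 ^ 2 + p 1 ^ 2 + 2 * p 2 ^ 2) * α₄ t,
     (-b * p 0 + a * p 1 + p 1 * p 2) * (1 + α₁ t)
        + p 1 * (a + p 2) * α₂ t - p 0 * α₃ t
        + p 0 * (p 0 ^ 2 + p 1 ^ 2) * (4 * a * p 2 + p 0 ^ 2 + p 1 ^ 2 + 2 * p 2 ^ 2) * α₄ t,
     -(2 * a * p 2 + p 0 ^ 2 + p 1 ^ 2 + p 2 ^ 2) * (1 + α₁ t + α₂ t)]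

/-- The explicit solution of the system with right-hand side `langfordField`. -/
def langfordSol (a b e : ℝ) (α₁ α₃ : ℝ → ℝ) (t : ℝ) : Phase :=
  !₂[√(-a * (a + e)) * sin (b * t + ∫ s in (0 : ℝ)..t, (b * α₁ s + α₃ s)),
     √(-a * (a + e)) * cos (b * t + ∫ s in (0 : ℝ)..t, (b * α₁ s + α₃ s)),
     -a]

/-- The explicit solution of the system with right-hand side `langfordField'`. -/
def langfordSol' (a b : ℝ) (α₁ α₃ α₄ : ℝ → ℝ) (t : ℝ) : Phase :=
  !₂[a * sin (b * t + ∫ s in (0 : ℝ)..t, (b * α₁ s + α₃ s + a ^ 4 * α₄ s)),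
     a * cos (b * t + ∫ s in (0 : ℝ)..t, (b * α₁ s + α₃ s + a ^ 4 * α₄ s)),
     -a]

/-- `φ` is a solution on `[t₀, ∞)` of `ẋ = f(t, x)` with `φ(t₀) = p` (at `t₀` the derivative is the
right derivative). -/
def IsForwardSol (f : ℝ → Phase → Phase) (t₀ : ℝ) (p : Phase) (φ : ℝ → Phase) : Prop :=
  φ t₀ = p ∧ IsIntegralCurveOn φ f (Ici t₀)

/-- Lyapunov stability, for the initial time `t₀`, of the solution `χ` of `ẋ = f(t, x)`: solutions
starting close to `χ t₀` at time `t₀` exist on `[t₀, ∞)` and stay close to `χ t` at each time. -/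
def LyapunovStableAt (f : ℝ → Phase → Phase) (χ : ℝ → Phase) (t₀ : ℝ) : Prop :=
  ∀ ε > 0, ∃ δ > 0, ∀ p : Phase, dist p (χ t₀) < δ →
    (∃ φ, IsForwardSol f t₀ p φ) ∧
    ∀ φ, IsForwardSol f t₀ p φ → ∀ t ≥ t₀, dist (φ t) (χ t) < ε

/-- Orbital stability, for the initial time `t₀`, of the solution `χ` of `ẋ = f(t, x)`: solutions
starting close to the orbit `{χ s}` at time `t₀` exist on `[t₀, ∞)` and stay close to the orbit. -/
def OrbitallyStableAt (f : ℝ → Phase → Phase) (χ : ℝ → Phase) (t₀ : ℝ) : Prop :=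
  ∀ ε > 0, ∃ δ > 0, ∀ p : Phase, Metric.infDist p (range χ) < δ →
    (∃ φ, IsForwardSol f t₀ p φ) ∧
    ∀ φ, IsForwardSol f t₀ p φ → ∀ t ≥ t₀, Metric.infDist (φ t) (range χ) < ε

/-- Asymptotic orbital stability, for the initial time `t₀`: orbital stability, and all solutions
starting close enough to the orbit at time `t₀` converge to the orbit. -/
def OrbitallyAsympStableAt (f : ℝ → Phase → Phase) (χ : ℝ → Phase) (t₀ : ℝ) : Prop :=
  OrbitallyStableAt f χ t₀ ∧
  ∃ δ > 0, ∀ p : Phase, Metric.infDist p (range χ) < δ →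
    ∀ φ, IsForwardSol f t₀ p φ →
      Tendsto (fun t => Metric.infDist (φ t) (range χ)) atTop (𝓝 0)

end

/-!
The horizontal part of the Langford field is `(a + z) g(t)` times `(x, y)` plus a rotation with
angular velocity `ω = b (1 + α₁) + α₃`, where `g = 1 + α₁ + α₂`, and its vertical part is
`g(t) (e z - x² - y² - z²)`. In the frame rotating by `θ = ∫ ω` the system therefore reads
`ψ' = g(t) F(ψ)` with an autonomous field `F` (`langfordCore`), and `χ` becomes the equilibrium
`(0, √(-a(a+e)), -a)`, one point of a circle of equilibria.

Periodicity of the field makes `α₁ + α₂` and `b α₁ + α₃` periodic; being odd they have zero mean, so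
that their primitives are periodic and bounded. Hence `χ` is periodic, `θ` is surjective, the orbit
is the whole circle, and the time change `τ = ∫ g` differs from `t` by a bounded function. The
function `g` may change sign, so `τ` need not be monotone; but `τ` is bounded below on `[t₀, ∞)`
and tends to infinity, and solutions are `Φ ∘ τ` with `Φ` an orbit of `F`.

With `q = -a(a+e)`, `c = 2a + e`, `σ = x² + y² - q` and `ζ = z + a`, orbits of `F` satisfy
`σ' = 2(q + σ)ζ`, `ζ' = cζ - σ - ζ²`. A quadratic form `V` in `(σ, ζ)` with a suitable cross term
satisfies `V' = c m` with `m` between two positive multiples of `V` near the circle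
(`exists_lyapunovRate_eq`). For `c < 0` this gives exponential decay of `V` forwards, and a bound on
its growth over the bounded stretch of negative times that `τ` may reach
(`langfordCore_stable`); for `c > 0` it gives exponential growth off the circle
(`langfordCore_unstable`). To have global orbits, `F` is cut off outside a large ball
(`ContDiff.exists_complete_eqOn_closedBall`). Lyapunov stability follows from the orbital estimate
because the direction of `(x, y)` is constant in the rotating frame (`langfordCore_direction`).
-/

/-! ### Integral curves of autonomous fields up to a time change -/

/-- A bounded, globally Lipschitz vector field is complete. -/
theorem LipschitzWith.exists_hasDerivAt_of_bounded {E : Type*} [NormedAddCommGroup E]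
    [NormedSpace ℝ E] [CompleteSpace E] {F : E → E} {K L : NNReal} (hF : LipschitzWith K F)
    (hL : ∀ x, ‖F x‖ ≤ L) (x : E) :
    ∃ γ : ℝ → E, γ 0 = x ∧ ∀ t, HasDerivAt γ (F (γ t)) t := by
  have key : ∀ n : ℝ, 0 < n → ∃ γ : ℝ → E, γ 0 = x ∧ ∀ t ∈ Ioo (-n) n,
      HasDerivAt γ (F (γ t)) t := by
    intro n hn
    have hPL : IsPicardLindelof (fun _ : ℝ => F) (tmin := -n) (tmax := n)
        ⟨0, by constructor <;> linarith⟩ x (L * n.toNNReal) 0 L K :=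
      { lipschitzOnWith := fun _ _ => hF.lipschitzOnWith
        continuousOn := fun _ _ => continuousOn_const
        norm_le := fun _ _ y _ => hL y
        mul_max_le := by simp [hn.le] }
    obtain ⟨γ, h0, h⟩ := hPL.exists_eq_forall_mem_Icc_hasDerivWithinAt₀
    exact ⟨γ, h0, fun t ht => (h t (Ioo_subset_Icc_self ht)).hasDerivAt (Icc_mem_nhds ht.1 ht.2)⟩
  choose! γ h0 hγ using key
  have heq : ∀ m n, 0 < m → m ≤ n → EqOn (γ m) (γ n) (Ioo (-m) m) := fun m n hm hmn =>
    ODE_solution_unique_of_mem_Ioo (v := fun _ => F) (s := fun _ => univ) (K := K) (t₀ := 0)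
      (fun _ _ => hF.lipschitzOnWith) ⟨by linarith, hm⟩
      (fun t ht => ⟨hγ m hm t ht, trivial⟩)
      (fun t ht => ⟨hγ n (by linarith) t ⟨by linarith [ht.1], by linarith [ht.2]⟩, trivial⟩)
      (by rw [h0 m hm, h0 n (by linarith)])
  refine ⟨fun t => γ (|t| + 1) t, h0 _ (by positivity), fun t => ?_⟩
  have hpos : 0 < |t| + 2 := by positivity
  have hmem : t ∈ Ioo (-(|t| + 1)) (|t| + 1) := abs_lt.1 (lt_add_one _)
  have hev : (fun s => γ (|s| + 1) s) =ᶠ[𝓝 t] γ (|t| + 2) := by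
    filter_upwards [Ioo_mem_nhds hmem.1 hmem.2] with s hs
    have : |s| < |t| + 1 := abs_lt.2 hs
    exact heq _ _ (by positivity) (by linarith) (abs_lt.1 (lt_add_one _))
  have ht : γ (|t| + 1) t = γ (|t| + 2) t := hev.eq_of_nhds
  simp only [ht]
  exact (hγ _ hpos t (abs_lt.1 (by linarith))).congr_of_eventuallyEq hev

/-- A `C¹` field can be modified outside any given ball so as to become a complete `C¹` field. -/
theorem ContDiff.exists_complete_eqOn_closedBall {E : Type*} [NormedAddCommGroup E]
    [NormedSpace ℝ E] [FiniteDimensional ℝ E] {F : E → E} (hF : ContDiff ℝ 1 F) {R : ℝ}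
    (hR : 0 < R) :
    ∃ G : E → E, ContDiff ℝ 1 G ∧ EqOn G F (Metric.closedBall 0 R) ∧
      ∀ x, ∃ γ : ℝ → E, γ 0 = x ∧ ∀ t, HasDerivAt γ (G (γ t)) t := by
  have : CompleteSpace E := FiniteDimensional.complete ℝ E
  let f : ContDiffBump (0 : E) := ⟨R, R + 1, hR, by linarith⟩
  have hG : ContDiff ℝ 1 (fun x => f x • F x) := f.contDiff.smul hF
  have hs : HasCompactSupport (fun x => f x • F x) := f.hasCompactSupport.smul_right
  obtain ⟨K, hK⟩ := ContDiff.lipschitzWith_of_hasCompactSupport hs hG one_ne_zero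
  obtain ⟨C, hC⟩ := hs.exists_bound_of_continuous hG.continuous
  refine ⟨_, hG, fun x hx => ?_, fun x => ?_⟩
  · simp [f.one_of_mem_closedBall hx]
  · exact hK.exists_hasDerivAt_of_bounded (L := C.toNNReal)
      (fun y => (hC y).trans (Real.le_coe_toNNReal C)) x

/-- Forward uniqueness for `ẋ = g(t) F(x)` with `g` continuous and `F` of class `C¹`. -/
theorem IsIntegralCurveOn.eqOn_Ici_smul {E : Type*} [NormedAddCommGroup E] [NormedSpace ℝ E]
    [FiniteDimensional ℝ E] {F : E → E} (hF : ContDiff ℝ 1 F) {g : ℝ → ℝ} (hg : Continuous g)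
    {t₀ : ℝ} {φ ψ : ℝ → E}
    (hφ : IsIntegralCurveOn φ (fun t p => g t • F p) (Ici t₀))
    (hψ : IsIntegralCurveOn ψ (fun t p => g t • F p) (Ici t₀)) (h₀ : φ t₀ = ψ t₀) :
    EqOn φ ψ (Ici t₀) := by
  intro t₁ ht₁
  have hcφ : ContinuousOn φ (Icc t₀ t₁) := hφ.continuousOn.mono Icc_subset_Ici_self
  have hcψ : ContinuousOn ψ (Icc t₀ t₁) := hψ.continuousOn.mono Icc_subset_Ici_self
  obtain ⟨R₁, h₁⟩ := isCompact_Icc.exists_bound_of_continuousOn hcφ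
  obtain ⟨R₂, h₂⟩ := isCompact_Icc.exists_bound_of_continuousOn hcψ
  obtain ⟨C, hC⟩ := (isCompact_Icc (a := t₀) (b := t₁)).exists_bound_of_continuousOn
    hg.continuousOn
  obtain ⟨K, hK⟩ := (hF.contDiffOn (s := Metric.closedBall 0 (max R₁ R₂))).exists_lipschitzOnWith
    one_ne_zero (convex_closedBall _ _) (isCompact_closedBall _ _)
  refine ODE_solution_unique_of_mem_Icc_right (v := fun t p => g t • F p)
    (s := fun _ => Metric.closedBall 0 (max R₁ R₂)) (K := C.toNNReal * K) ?_ hcφ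
    (fun t ht => (hφ t ht.1).mono (Ici_subset_Ici.2 ht.1)) ?_ hcψ
    (fun t ht => (hψ t ht.1).mono (Ici_subset_Ici.2 ht.1)) ?_ h₀ (right_mem_Icc.2 ht₁)
  · intro t ht
    refine LipschitzOnWith.of_dist_le_mul fun x hx y hy => ?_
    rw [dist_smul₀, NNReal.coe_mul, mul_assoc]
    exact mul_le_mul ((hC t (Ico_subset_Icc_self ht)).trans (Real.le_coe_toNNReal C))
      (hK.dist_le_mul x hx y hy) dist_nonneg (NNReal.coe_nonneg _)
  · exact fun t ht => mem_closedBall_zero_iff.2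
      ((h₁ t (Ico_subset_Icc_self ht)).trans (le_max_left _ _))
  · exact fun t ht => mem_closedBall_zero_iff.2
      ((h₂ t (Ico_subset_Icc_self ht)).trans (le_max_right _ _))

/-! ### Exponential bounds for scalar functions in a trapping region -/

/-- If `f' < k f` wherever `0 < f < r`, then `f` stays below every exponential `D exp (k s)` lying
below `r` that dominates it initially. -/
theorem le_mul_exp_of_deriv_lt {f f' : ℝ → ℝ} {k r D N : ℝ} (hf : ∀ s, HasDerivAt f (f' s) s)
    (hk : ∀ s, 0 < f s → f s < r → f' s < k * f s) (hD : 0 < D)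
    (hr : ∀ s ∈ Icc 0 N, D * exp (k * s) < r) (h0 : f 0 ≤ D) :
    ∀ s ∈ Icc 0 N, f s ≤ D * exp (k * s) := by
  intro s hs
  refine image_le_of_deriv_right_lt_deriv_boundary (f' := f') (B := fun s => D * exp (k * s))
    (B' := fun s => k * (D * exp (k * s)))
    (fun s _ => (hf s).continuousAt.continuousWithinAt) (fun s _ => (hf s).hasDerivWithinAt)
    (by simpa using h0) (fun s => ?_) (fun s hs h => ?_) hs
  · have : HasDerivAt (fun s => exp (k * s)) (exp (k * s) * k) s := by
      simpa using ((hasDerivAt_id' s).const_mul k).exp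
    exact (this.const_mul D).congr_deriv (by ring)
  · have := hk s (by rw [h]; positivity) (by rw [h]; exact hr s (Ico_subset_Icc_self hs))
    rwa [h] at this

/-- A function with `f' ≥ κ f`, `κ > 0`, and positive initial value cannot stay bounded. -/
theorem not_forall_lt_of_mul_le_deriv {f f' : ℝ → ℝ} {κ r : ℝ} (hκ : 0 < κ)
    (hf : ∀ s ≥ 0, HasDerivAt f (f' s) s) (hk : ∀ s ≥ 0, κ * f s ≤ f' s) (h0 : 0 < f 0) :
    ¬ ∀ s ≥ 0, f s < r := by
  intro hr
  have hmono : MonotoneOn (fun s => f s * exp (-κ * s)) (Ici 0) := by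
    have hd : ∀ s ≥ 0, HasDerivAt (fun s => f s * exp (-κ * s))
        (f' s * exp (-κ * s) + f s * (exp (-κ * s) * (-κ))) s := fun s hs => by
      have : HasDerivAt (fun s => exp (-κ * s)) (exp (-κ * s) * (-κ)) s := by
        simpa using ((hasDerivAt_id' s).const_mul (-κ)).exp
      exact (hf s hs).fun_mul this
    refine monotoneOn_of_deriv_nonneg (convex_Ici 0)
      (fun s hs => (hd s hs).continuousAt.continuousWithinAt)
      (fun s hs => (hd s (interior_subset hs)).differentiableAt.differentiableWithinAt)
      (fun s hs => ?_)
    rw [(hd s (interior_subset hs)).deriv]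
    have := hk s (interior_subset hs)
    nlinarith [exp_pos (-κ * s)]
  have hlow : ∀ s ≥ 0, f 0 * exp (κ * s) ≤ f s := fun s hs => by
    have h := hmono (mem_Ici.2 le_rfl) (mem_Ici.2 hs) hs
    simp only [mul_zero, exp_zero, mul_one] at h
    calc f 0 * exp (κ * s) ≤ f s * exp (-κ * s) * exp (κ * s) := by gcongr
      _ = f s := by rw [mul_assoc, ← exp_add]; simp
  have htend : Tendsto (fun s => f 0 * exp (κ * s)) atTop atTop :=
    (tendsto_exp_atTop.comp (tendsto_id.const_mul_atTop hκ)).const_mul_atTop h0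
  obtain ⟨s, hs, hs0⟩ := ((htend.eventually_ge_atTop r).and (eventually_ge_atTop 0)).exists
  linarith [hlow s hs0, hr s hs0]

/-! ### Primitives of odd periodic functions -/

/-- The primitive of a continuous odd periodic function is periodic. -/
theorem Function.Periodic.integral_of_odd {h : ℝ → ℝ} {T : ℝ} (hc : Continuous h)
    (ho : Function.Odd h) (hp : Function.Periodic h T) :
    Function.Periodic (fun t => ∫ s in (0 : ℝ)..t, h s) T := by
  intro t
  have hI : ∀ u v : ℝ, IntervalIntegrable h volume u v := fun u v => hc.intervalIntegrable u v
  have h1 : ∫ s in (-(T / 2))..(T / 2), h s = 0 := by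
    have h2 := intervalIntegral.integral_comp_neg (a := -(T / 2)) (b := T / 2) h
    simp only [ho _, intervalIntegral.integral_neg, neg_neg] at h2
    linarith
  have h3 := hp.intervalIntegral_add_eq t (-(T / 2))
  rw [show -(T / 2) + T = T / 2 by ring, h1] at h3
  simp only
  rw [← intervalIntegral.integral_add_adjacent_intervals (hI 0 t) (hI t (t + T)), h3, add_zero]

theorem Function.Periodic.exists_abs_integral_le_of_odd {h : ℝ → ℝ} {T : ℝ} (hT : T ≠ 0)
    (hc : Continuous h) (ho : Function.Odd h) (hp : Function.Periodic h T) :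
    ∃ M, ∀ t, |∫ s in (0 : ℝ)..t, h s| ≤ M := by
  have hcont : Continuous (fun t => ∫ s in (0 : ℝ)..t, h s) :=
    intervalIntegral.continuous_primitive (fun u v => hc.intervalIntegrable u v) 0
  obtain ⟨M, hM⟩ := (isBounded_iff_forall_norm_le).1
    ((hp.integral_of_odd hc ho).isBounded_of_continuous hT hcont)
  exact ⟨M, fun t => hM _ ⟨t, rfl⟩⟩

/-! ### A strict Lyapunov function for the reduced planar system -/

/-- Quadratic form in the deviations `σ = x² + y² - q` and `ζ = z + a` from the invariant circle.
The cross term makes its derivative along `σ' = 2(q + σ)ζ`, `ζ' = cζ - σ - ζ²` definite at second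
order, with the sign of `c`. -/
noncomputable def lyapunovForm (q c σ ζ : ℝ) : ℝ :=
  σ ^ 2 + 2 * q * ζ ^ 2 - 2 * (c * (q / (2 * q + c ^ 2))) * σ * ζ

/-- Derivative of `lyapunovForm` along the field `σ' = 2(q + σ)ζ`, `ζ' = cζ - σ - ζ²`. -/
noncomputable def lyapunovRate (q c σ ζ : ℝ) : ℝ :=
  (2 * σ - 2 * (c * (q / (2 * q + c ^ 2))) * ζ) * (2 * (q + σ) * ζ)
    + (4 * q * ζ - 2 * (c * (q / (2 * q + c ^ 2))) * σ) * (c * ζ - σ - ζ ^ 2)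

section Planar

variable {q : ℝ} (c σ ζ : ℝ)

theorem lyapunov_coeff_bounds (hq : 0 < q) :
    0 < q / (2 * q + c ^ 2) ∧ q / (2 * q + c ^ 2) ≤ 1 / 2 ∧ q / (2 * q + c ^ 2) * c ^ 2 ≤ q := by
  have hd : 0 < 2 * q + c ^ 2 := by positivity
  refine ⟨by positivity, ?_, ?_⟩
  · rw [div_le_iff₀ hd]; nlinarith [sq_nonneg c]
  · rw [div_mul_eq_mul_div, div_le_iff₀ hd]; nlinarith

theorem lyapunov_cross_bound (hq : 0 < q) :
    |2 * (c * (q / (2 * q + c ^ 2))) * σ * ζ| ≤ σ ^ 2 / 2 + q * ζ ^ 2 := by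
  obtain ⟨h0, h1, h2⟩ := lyapunov_coeff_bounds c hq
  set ν := q / (2 * q + c ^ 2)
  have h3 : (c * ν) ^ 2 ≤ q / 2 := by nlinarith
  have h4 : (c * ν) ^ 2 * ζ ^ 2 ≤ q / 2 * ζ ^ 2 := by gcongr
  rw [abs_le]
  constructor
  · nlinarith [sq_nonneg (σ + 2 * (c * ν) * ζ)]
  · nlinarith [sq_nonneg (σ - 2 * (c * ν) * ζ)]

theorem le_lyapunovForm (hq : 0 < q) : σ ^ 2 / 2 + q * ζ ^ 2 ≤ lyapunovForm q c σ ζ := by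
  have := (abs_le.1 (lyapunov_cross_bound c σ ζ hq)).2
  unfold lyapunovForm; linarith

theorem lyapunovForm_le (hq : 0 < q) :
    lyapunovForm q c σ ζ ≤ 3 / 2 * σ ^ 2 + 3 * q * ζ ^ 2 := by
  have := (abs_le.1 (lyapunov_cross_bound c σ ζ hq)).1
  unfold lyapunovForm; linarith

/-- Close to the equilibrium the rate is `c` times a quantity comparable with the form itself. -/
theorem exists_lyapunovRate_eq (hq : 0 < q) (hc : c ≠ 0)
    (hζ : |ζ| ≤ |c| * (q / (2 * q + c ^ 2)) / 30) :
    ∃ m, lyapunovRate q c σ ζ = c * m ∧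
      q / (2 * q + c ^ 2) / 3 * lyapunovForm q c σ ζ ≤ m ∧ m ≤ 6 * lyapunovForm q c σ ζ := by
  have hlow := le_lyapunovForm c σ ζ hq
  have hup := lyapunovForm_le c σ ζ hq
  have hcr := abs_le.1 (lyapunov_cross_bound c σ ζ hq)
  obtain ⟨h0, h1, h2⟩ := lyapunov_coeff_bounds c hq
  set V := lyapunovForm q c σ ζ with hV
  set ν := q / (2 * q + c ^ 2) with hν
  have hqζ : 0 ≤ q * ζ ^ 2 := by positivity
  have hV0 : 0 ≤ V := le_trans (by positivity) hlow
  -- the rate is `c * Q + ζ * C` with `Q` a positive definite form and `C` a quadratic form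
  set Q := (4 * q - 4 * ν * q) * ζ ^ 2 + 2 * ν * σ ^ 2 - 2 * ν * c * σ * ζ with hQ
  set C := 4 * σ ^ 2 - 2 * (c * ν) * σ * ζ - 4 * q * ζ ^ 2 with hC
  have hrate : lyapunovRate q c σ ζ = c * Q + ζ * C := by
    unfold lyapunovRate; rw [← hν, hQ, hC]; ring
  have hcross : |2 * ν * c * σ * ζ| ≤ ν * σ ^ 2 + q * ζ ^ 2 := by
    have h4 : ν * c ^ 2 * ζ ^ 2 ≤ q * ζ ^ 2 := by gcongr
    rw [abs_le]
    constructor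
    · nlinarith [mul_nonneg h0.le (sq_nonneg (σ + c * ζ))]
    · nlinarith [mul_nonneg h0.le (sq_nonneg (σ - c * ζ))]
  have hνq : ν * (q * ζ ^ 2) ≤ 1 / 2 * (q * ζ ^ 2) := by gcongr
  have hνσ : ν * σ ^ 2 ≤ 1 / 2 * σ ^ 2 := by gcongr
  have hνV : ν * V ≤ ν * (3 / 2 * σ ^ 2 + 3 * q * ζ ^ 2) := by gcongr
  rw [abs_le] at hcross
  have hQlow : ν * (2 / 3) * V ≤ Q := by rw [hQ]; nlinarith
  have hQup : Q ≤ 5 * V := by rw [hQ]; nlinarith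
  have hCV : |C| ≤ 10 * V := by
    rw [abs_le, hC]; constructor <;> nlinarith
  have hE : |ζ * C / c| ≤ ν / 3 * V := by
    rw [abs_div, abs_mul, div_le_iff₀ (abs_pos.2 hc)]
    calc |ζ| * |C| ≤ (|c| * ν / 30) * (10 * V) := by gcongr
      _ = ν / 3 * V * |c| := by ring
  rw [abs_le] at hE
  refine ⟨Q + ζ * C / c, ?_, ?_, ?_⟩
  · rw [hrate]; field_simp
  · linarith [hE.1]
  · nlinarith [hE.2]

end Planar

/-! ### The autonomous system in the rotating frame -/

/-- The autonomous field to which the Langford system reduces in a rotating frame and after a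
change of time. -/
noncomputable def langfordCore (a e : ℝ) (p : Phase) : Phase :=
  !₂[p 0 * (a + p 2), p 1 * (a + p 2), e * p 2 - p 0 ^ 2 - p 1 ^ 2 - p 2 ^ 2]

/-- The Lyapunov function of `langfordCore`, vanishing exactly on the circle
`x² + y² = -a(a+e)`, `z = -a`. -/
noncomputable def langfordLyap (a e : ℝ) (p : Phase) : ℝ :=
  lyapunovForm (-a * (a + e)) (2 * a + e) (p 0 ^ 2 + p 1 ^ 2 - -a * (a + e)) (p 2 + a)

theorem hasDerivWithinAt_phase {φ : ℝ → Phase} {φ' : Phase} {s : Set ℝ} {t : ℝ} :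
    HasDerivWithinAt φ φ' s t ↔ HasDerivWithinAt (fun t => φ t 0) (φ' 0) s t ∧
      HasDerivWithinAt (fun t => φ t 1) (φ' 1) s t ∧
      HasDerivWithinAt (fun t => φ t 2) (φ' 2) s t := by
  have h : HasDerivWithinAt φ φ' s t ↔
      ∀ i, HasDerivWithinAt (fun t => φ t i) (φ' i) s t := by
    rw [hasDerivWithinAt_iff_hasFDerivWithinAt, hasFDerivWithinAt_euclidean]
    refine forall_congr' fun i => ?_
    rw [hasDerivWithinAt_iff_hasFDerivWithinAt]
    refine iff_of_eq (congrArg (fun L => HasFDerivWithinAt (fun t => φ t i) L s t) ?_)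
    ext
    simp
  rw [h, Fin.forall_fin_succ, Fin.forall_fin_two]
  rfl

theorem hasDerivAt_phase {φ : ℝ → Phase} {φ' : Phase} {t : ℝ} :
    HasDerivAt φ φ' t ↔ HasDerivAt (fun t => φ t 0) (φ' 0) t ∧
      HasDerivAt (fun t => φ t 1) (φ' 1) t ∧ HasDerivAt (fun t => φ t 2) (φ' 2) t := by
  simp only [← hasDerivWithinAt_univ, hasDerivWithinAt_phase]

theorem contDiff_langfordCore (a e : ℝ) : ContDiff ℝ 1 (langfordCore a e) := by
  rw [contDiff_euclidean]
  intro i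
  fin_cases i <;> simp [langfordCore] <;> fun_prop

theorem langfordLyap_nonneg {a e : ℝ} (h : a * (a + e) < 0) (p : Phase) :
    0 ≤ langfordLyap a e p := by
  have hq : 0 < -a * (a + e) := by linarith
  exact le_trans (by positivity) (le_lyapunovForm _ _ _ hq)

/-- Derivative of the Lyapunov function along an arbitrary curve. -/
theorem hasDerivAt_langfordLyap (a e : ℝ) {Φ : ℝ → Phase} {t : ℝ} {w : Phase}
    (h : HasDerivAt Φ w t) :
    HasDerivAt (fun t => langfordLyap a e (Φ t)) (fderiv ℝ (langfordLyap a e) (Φ t) w) t := by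
  have hd : Differentiable ℝ (langfordLyap a e) := by
    unfold langfordLyap lyapunovForm
    fun_prop
  exact (hd (Φ t)).hasFDerivAt.comp_hasDerivAt t h

theorem fderiv_langfordLyap_core (a e : ℝ) (p : Phase) :
    fderiv ℝ (langfordLyap a e) p (langfordCore a e p) =
      lyapunovRate (-a * (a + e)) (2 * a + e) (p 0 ^ 2 + p 1 ^ 2 - -a * (a + e)) (p 2 + a) := by
  set w := langfordCore a e p with hw
  have hline : HasDerivAt (fun s : ℝ => p + s • w) w 0 := by
    simpa using ((hasDerivAt_id' (0 : ℝ)).smul_const w).const_add p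
  have h1 := hasDerivAt_langfordLyap a e hline
  simp only [zero_smul, add_zero] at h1
  obtain ⟨h0', h1', h2'⟩ := hasDerivAt_phase.1 hline
  have hσ := ((h0'.fun_pow 2).fun_add (h1'.fun_pow 2)).sub_const (-a * (a + e))
  have hζ := h2'.add_const a
  have h2 := ((hσ.fun_pow 2).fun_add ((hζ.fun_pow 2).const_mul (2 * (-a * (a + e))))).fun_sub
    ((hσ.const_mul (2 * ((2 * a + e) * ((-a * (a + e)) /
      (2 * (-a * (a + e)) + (2 * a + e) ^ 2))))).fun_mul hζ)
  rw [h1.unique h2, hw]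
  simp only [lyapunovRate, langfordCore, zero_smul, add_zero]
  simp
  ring

/-! ### Orbits of the autonomous field near the circle -/

/-- A sublevel set of the Lyapunov function that is bounded, avoids the axis `x = y = 0`, and in
which the orbital derivative is `2a + e` times a quantity comparable with the function. -/
theorem exists_langfordLyap_region {a e : ℝ} (h : a * (a + e) < 0) (hc : 2 * a + e ≠ 0) :
    ∃ r > 0, ∃ κ > 0, ∃ R > 0, ∀ p : Phase, langfordLyap a e p < r →
      p ∈ Metric.closedBall 0 R ∧ 0 < p 0 ^ 2 + p 1 ^ 2 ∧
      ∃ m, fderiv ℝ (langfordLyap a e) p (langfordCore a e p) = (2 * a + e) * m ∧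
        κ * langfordLyap a e p ≤ m ∧ m ≤ 6 * langfordLyap a e p := by
  have hq : 0 < -a * (a + e) := by linarith
  obtain ⟨h0, h1, h2⟩ := lyapunov_coeff_bounds (2 * a + e) hq
  set q := -a * (a + e) with hqdef
  set c := 2 * a + e with hcdef
  set ν := q / (2 * q + c ^ 2) with hν
  have hcν : 0 < |c| * ν / 30 := by positivity
  have hr2 : 2 * (q * (|c| * ν / 30) ^ 2) ≤ q ^ 2 := by
    have : (|c| * ν / 30) ^ 2 = c ^ 2 * ν ^ 2 / 900 := by
      rw [div_pow, mul_pow, sq_abs]; norm_num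
    rw [this]
    have h3 : c ^ 2 * ν ^ 2 ≤ q / 2 := by nlinarith
    nlinarith
  set r := q * (|c| * ν / 30) ^ 2 with hr
  have hr0 : 0 < r := by positivity
  set R := 2 * q + 2 * (|c| * ν / 30) ^ 2 + 2 * a ^ 2 + 1 with hR
  have hR1 : 1 ≤ R := by rw [hR]; nlinarith [sq_nonneg (|c| * ν / 30), sq_nonneg a]
  refine ⟨r, hr0, ν / 3, by positivity, R, by linarith, fun p hp => ?_⟩
  have hlow := le_lyapunovForm c (p 0 ^ 2 + p 1 ^ 2 - q) (p 2 + a) hq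
  have hVdef : langfordLyap a e p = lyapunovForm q c (p 0 ^ 2 + p 1 ^ 2 - q) (p 2 + a) := rfl
  rw [← hVdef] at hlow
  set σ := p 0 ^ 2 + p 1 ^ 2 - q with hσ
  have hζ2 : (p 2 + a) ^ 2 < (|c| * ν / 30) ^ 2 := by
    have : q * (p 2 + a) ^ 2 < q * (|c| * ν / 30) ^ 2 := by nlinarith [sq_nonneg σ]
    exact lt_of_mul_lt_mul_left this hq.le
  have hζ : |p 2 + a| ≤ |c| * ν / 30 := (abs_le_of_sq_le_sq' hζ2.le hcν.le) |> abs_le.2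
  have hσ2 : |σ| < q := abs_lt_of_sq_lt_sq (by nlinarith [sq_nonneg (p 2 + a)]) hq.le
  rw [abs_lt] at hσ2
  refine ⟨?_, by linarith [hσ2.1], ?_⟩
  · rw [mem_closedBall_zero_iff]
    refine abs_le_of_sq_le_sq (a := ‖p‖) ?_ (by linarith) |> (le_abs_self _).trans
    have hn : ‖p‖ ^ 2 = p 0 ^ 2 + p 1 ^ 2 + p 2 ^ 2 := by
      rw [EuclideanSpace.real_norm_sq_eq, Fin.sum_univ_three]
    have : ‖p‖ ^ 2 ≤ R := by
      rw [hn, hR]; nlinarith [hσ2.2, sq_nonneg (p 2 + 2 * a)]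
    nlinarith
  · rw [fderiv_langfordLyap_core]
    exact exists_lyapunovRate_eq c σ (p 2 + a) hq hc hζ

/-- For `2a + e < 0` orbits of the autonomous field starting near the circle exist on `[-M, ∞)`
and approach the circle exponentially. Negative times are needed because the time change of the
Langford system need not be monotone. -/
theorem langfordCore_stable {a e : ℝ} (h : a * (a + e) < 0) (hc : 2 * a + e < 0) :
    ∃ r > 0, ∃ κ > 0, ∃ K > 0, ∀ M ≥ 0, ∀ (p : Phase) (D : ℝ), 0 < D → D * exp (K * M) < r →
      langfordLyap a e p ≤ D → ∃ Φ : ℝ → Phase, Φ 0 = p ∧ ∀ s ≥ -M,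
        HasDerivAt Φ (langfordCore a e (Φ s)) s ∧ 0 < Φ s 0 ^ 2 + Φ s 1 ^ 2 ∧
        langfordLyap a e (Φ s) ≤ D * exp (K * M) * exp (-κ * s) := by
  obtain ⟨r, hr, κ, hκ, R, hR, hreg⟩ := exists_langfordLyap_region h hc.ne
  obtain ⟨G, -, hGF, hG⟩ := (contDiff_langfordCore a e).exists_complete_eqOn_closedBall hR
  set c := 2 * a + e
  have hK : 0 < -(7 * c) := by linarith
  have hκ' : 0 < -(c * κ / 2) := by nlinarith
  refine ⟨r, hr, -(c * κ / 2), hκ', -(7 * c), hK, fun M hM p D hD hDr hp => ?_⟩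
  obtain ⟨Φ, hΦ0, hΦ⟩ := hG p
  have hV := fun s => hasDerivAt_langfordLyap a e (hΦ s)
  have hrate : ∀ s, langfordLyap a e (Φ s) < r →
      ∃ m, fderiv ℝ (langfordLyap a e) (Φ s) (G (Φ s)) = c * m ∧
        κ * langfordLyap a e (Φ s) ≤ m ∧ m ≤ 6 * langfordLyap a e (Φ s) := fun s hs => by
    rw [hGF (hreg _ hs).1]
    exact (hreg _ hs).2.2
  have hDM : D ≤ D * exp (-(7 * c) * M) :=
    le_mul_of_one_le_right hD.le (one_le_exp (by positivity))
  have hfwd : ∀ s ≥ 0, langfordLyap a e (Φ s) ≤ D * exp (c * κ / 2 * s) := fun s hs => by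
    refine le_mul_exp_of_deriv_lt (N := s) (r := r) hV (fun s h0 h1 => ?_) hD (fun s hs => ?_)
      (by simpa only [hΦ0] using hp) s ⟨hs, le_rfl⟩
    · obtain ⟨m, hm, hm1, -⟩ := hrate s h1
      rw [hm]
      nlinarith [mul_pos hκ' h0]
    · have : exp (c * κ / 2 * s) ≤ 1 := exp_le_one_iff.2 (by nlinarith [hs.1])
      nlinarith
  have hbwd : ∀ s ∈ Icc 0 M, langfordLyap a e (Φ (-s)) ≤ D * exp (-(7 * c) * s) := by
    refine le_mul_exp_of_deriv_lt (f := fun s => langfordLyap a e (Φ (-s)))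
      (f' := fun s => -fderiv ℝ (langfordLyap a e) (Φ (-s)) (G (Φ (-s)))) (r := r)
      (fun s => ?_) (fun s h0 h1 => ?_) hD (fun s hs => ?_) (by simpa [hΦ0] using hp)
    · exact ((hV (-s)).scomp s (hasDerivAt_neg s)).congr_deriv (by simp)
    · obtain ⟨m, hm, -, hm2⟩ := hrate (-s) h1
      rw [hm]
      nlinarith
    · refine lt_of_le_of_lt ?_ hDr
      gcongr
      exact hs.2
  have hbound : ∀ s ≥ -M, langfordLyap a e (Φ s) ≤
      D * exp (-(7 * c) * M) * exp (-(-(c * κ / 2)) * s) ∧ langfordLyap a e (Φ s) < r := by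
    intro s hs
    rcases le_total 0 s with h0 | h0
    · have h1 := hfwd s h0
      rw [neg_neg]
      have h2 : exp (c * κ / 2 * s) ≤ 1 := exp_le_one_iff.2 (by nlinarith)
      refine ⟨h1.trans (by gcongr), ?_⟩
      nlinarith
    · have h1 := hbwd (-s) ⟨by linarith, by linarith⟩
      rw [neg_neg] at h1
      have h2 : D * exp (-(7 * c) * -s) ≤ D * exp (-(7 * c) * M) := by
        gcongr
        linarith
      have h3 : 1 ≤ exp (-(-(c * κ / 2)) * s) := one_le_exp (by nlinarith)
      refine ⟨h1.trans (h2.trans (le_mul_of_one_le_right (by positivity) h3)), by linarith⟩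
  refine ⟨Φ, hΦ0, fun s hs => ⟨?_, (hreg _ (hbound s hs).2).2.1, (hbound s hs).1⟩⟩
  rw [← hGF (hreg _ (hbound s hs).2).1]
  exact hΦ s

/-- Reparametrizing an orbit of an autonomous field by `τ` multiplies the field by `τ'`. -/
theorem isIntegralCurveOn_smul_of_comp {F : Phase → Phase} {Φ : ℝ → Phase} {τ g : ℝ → ℝ}
    {s : Set ℝ} (hτ : ∀ t, HasDerivAt τ (g t) t) (hΦ : ∀ t ∈ s, HasDerivAt Φ (F (Φ (τ t))) (τ t)) :
    IsIntegralCurveOn (Φ ∘ τ) (fun t p => g t • F p) s := fun t ht =>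
  ((hΦ t ht).scomp t (hτ t)).hasDerivWithinAt

/-- The stability estimate for the reduced system `ψ' = g(t) F(ψ)`, where `τ` is a primitive
of `g`. -/
theorem langfordCore_stable_timeChange {a e : ℝ} (h : a * (a + e) < 0) (hc : 2 * a + e < 0)
    {g τ : ℝ → ℝ} {t₀ M : ℝ} (hg : Continuous g) (hτ : ∀ t, HasDerivAt τ (g t) t)
    (hτ₀ : τ t₀ = 0) (hM : 0 ≤ M) (hτM : ∀ t ≥ t₀, -M ≤ τ t) :
    ∃ D₀ > 0, ∃ C > 0, ∃ κ > 0, ∀ (p : Phase) (D : ℝ), 0 < D → D < D₀ →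
      langfordLyap a e p ≤ D →
      (∃ ψ : ℝ → Phase, ψ t₀ = p ∧
        IsIntegralCurveOn ψ (fun t p => g t • langfordCore a e p) (Ici t₀)) ∧
      ∀ ψ : ℝ → Phase, ψ t₀ = p →
        IsIntegralCurveOn ψ (fun t p => g t • langfordCore a e p) (Ici t₀) →
        ∀ t ≥ t₀, 0 < ψ t 0 ^ 2 + ψ t 1 ^ 2 ∧
          langfordLyap a e (ψ t) ≤ C * D * exp (-κ * τ t) := by
  obtain ⟨r, hr, κ, hκ, K, hK, hst⟩ := langfordCore_stable h hc
  refine ⟨r / exp (K * M), by positivity, exp (K * M), by positivity, κ, hκ,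
    fun p D hD hD₀ hp => ?_⟩
  obtain ⟨Φ, hΦ0, hΦ⟩ := hst M hM p D hD ((lt_div_iff₀ (exp_pos _)).1 hD₀) hp
  have hcurve : IsIntegralCurveOn (Φ ∘ τ) (fun t p => g t • langfordCore a e p) (Ici t₀) :=
    isIntegralCurveOn_smul_of_comp hτ fun t ht => (hΦ _ (hτM t ht)).1
  have h0 : (Φ ∘ τ) t₀ = p := by simp [hτ₀, hΦ0]
  refine ⟨⟨_, h0, hcurve⟩, fun ψ hψ0 hψ t ht => ?_⟩
  have heq := hψ.eqOn_Ici_smul (contDiff_langfordCore a e) hg hcurve (hψ0.trans h0.symm) ht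
  rw [heq, mul_comm (exp _)]
  exact (hΦ _ (hτM t ht)).2

/-- For `2a + e > 0` no solution of `ψ' = g(t) F(ψ)` off the circle stays near the circle, provided
the primitive `τ` of `g` tends to infinity. -/
theorem langfordCore_unstable {a e : ℝ} (h : a * (a + e) < 0) (hc : 0 < 2 * a + e) :
    ∃ r > 0, ∀ (g τ : ℝ → ℝ) (t₀ : ℝ) (ψ : ℝ → Phase), Continuous g →
      (∀ t, HasDerivAt τ (g t) t) → τ t₀ = 0 → Tendsto τ atTop atTop →
      IsIntegralCurveOn ψ (fun t p => g t • langfordCore a e p) (Ici t₀) →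
      0 < langfordLyap a e (ψ t₀) → ¬ ∀ t ≥ t₀, langfordLyap a e (ψ t) < r := by
  obtain ⟨r, hr, κ, hκ, R, hR, hreg⟩ := exists_langfordLyap_region h hc.ne'
  obtain ⟨G, hGc, hGF, hG⟩ := (contDiff_langfordCore a e).exists_complete_eqOn_closedBall hR
  refine ⟨r, hr, fun g τ t₀ ψ hg hτ hτ₀ hτtop hψ hpos hlt => ?_⟩
  obtain ⟨Φ, hΦ0, hΦ⟩ := hG (ψ t₀)
  have hψ' : IsIntegralCurveOn ψ (fun t p => g t • G p) (Ici t₀) := fun t ht => by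
    simp only [hGF (hreg _ (hlt t ht)).1]
    exact hψ t ht
  have heq := hψ'.eqOn_Ici_smul hGc hg
    (isIntegralCurveOn_smul_of_comp (Φ := Φ) hτ fun t _ => hΦ (τ t)) (by simp [hτ₀, hΦ0])
  have hτc : Continuous τ := continuous_iff_continuousAt.2 fun t => (hτ t).continuousAt
  -- every `s ≥ 0` is a value of the time change, even if it is not monotone
  have hsurj : ∀ s ≥ 0, ∃ t ≥ t₀, τ t = s := fun s hs => by
    obtain ⟨t₁, ht₁, hs₁⟩ := ((hτtop.eventually_ge_atTop s).and (eventually_ge_atTop t₀)).exists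
    obtain ⟨t, ht, hts⟩ := intermediate_value_Icc hs₁ hτc.continuousOn
      (show s ∈ Icc (τ t₀) (τ t₁) from ⟨by rwa [hτ₀], ht₁⟩)
    exact ⟨t, ht.1, hts⟩
  have hΦr : ∀ s ≥ 0, langfordLyap a e (Φ s) < r := fun s hs => by
    obtain ⟨t, ht, rfl⟩ := hsurj s hs
    have := hlt t ht
    rwa [heq ht] at this
  refine not_forall_lt_of_mul_le_deriv (κ := (2 * a + e) * κ) (by positivity)
    (fun s _ => hasDerivAt_langfordLyap a e (hΦ s)) (fun s hs => ?_) (by rwa [hΦ0]) hΦr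
  obtain ⟨hball, -, m, hm, hm1, -⟩ := hreg _ (hΦr s hs)
  rw [hGF hball, hm, mul_assoc]
  gcongr

/-- Along `ψ' = g(t) F(ψ)` the direction of the horizontal part `(x, y)` is constant. -/
theorem langfordCore_direction {a e : ℝ} {g : ℝ → ℝ} {t₀ : ℝ} {ψ : ℝ → Phase}
    (hψ : IsIntegralCurveOn ψ (fun t p => g t • langfordCore a e p) (Ici t₀))
    (hpos : ∀ t ≥ t₀, 0 < ψ t 0 ^ 2 + ψ t 1 ^ 2) {t : ℝ} (ht : t₀ ≤ t) :
    √(ψ t₀ 0 ^ 2 + ψ t₀ 1 ^ 2) * ψ t 0 = √(ψ t 0 ^ 2 + ψ t 1 ^ 2) * ψ t₀ 0 ∧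
    √(ψ t₀ 0 ^ 2 + ψ t₀ 1 ^ 2) * ψ t 1 = √(ψ t 0 ^ 2 + ψ t 1 ^ 2) * ψ t₀ 1 := by
  have hsq : ∀ s ≥ t₀, HasDerivWithinAt (fun s => √(ψ s 0 ^ 2 + ψ s 1 ^ 2))
      (g s * (a + ψ s 2) * √(ψ s 0 ^ 2 + ψ s 1 ^ 2)) (Ici t₀) s := fun s hs => by
    obtain ⟨h0, h1, -⟩ := hasDerivWithinAt_phase.1 (hψ s hs)
    refine (((h0.fun_pow 2).fun_add (h1.fun_pow 2)).sqrt (hpos s hs).ne').congr_deriv ?_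
    have hs0 := sqrt_pos.2 (hpos s hs)
    rw [div_eq_iff (by positivity), mul_assoc (g s * (a + ψ s 2)), mul_left_comm _ (2 : ℝ),
      mul_self_sqrt (hpos s hs).le]
    simp [langfordCore]
    ring
  have hconst : ∀ u : ℝ → ℝ, (∀ s ≥ t₀, HasDerivWithinAt u (g s * (a + ψ s 2) * u s)
      (Ici t₀) s) → √(ψ t₀ 0 ^ 2 + ψ t₀ 1 ^ 2) * u t = √(ψ t 0 ^ 2 + ψ t 1 ^ 2) * u t₀ := by
    intro u hu
    have hd : ∀ s ≥ t₀, HasDerivWithinAt (fun s => u s / √(ψ s 0 ^ 2 + ψ s 1 ^ 2)) 0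
        (Ici t₀) s := fun s hs => by
      have hs0 := sqrt_pos.2 (hpos s hs)
      refine ((hu s hs).fun_div (hsq s hs) hs0.ne').congr_deriv ?_
      rw [div_eq_zero_iff]
      left
      ring
    have := constant_of_has_deriv_right_zero (a := t₀) (b := t)
      (fun s hs => (hd s hs.1).continuousWithinAt.mono Icc_subset_Ici_self)
      (fun s hs => (hd s hs.1).mono (Ici_subset_Ici.2 hs.1)) t ⟨ht, le_rfl⟩
    rw [div_eq_div_iff (sqrt_pos.2 (hpos t ht)).ne' (sqrt_pos.2 (hpos t₀ le_rfl)).ne'] at this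
    linarith
  refine ⟨hconst (fun s => ψ s 0) fun s hs => ?_, hconst (fun s => ψ s 1) fun s hs => ?_⟩
  · refine (hasDerivWithinAt_phase.1 (hψ s hs)).1.congr_deriv ?_
    simp [langfordCore]
    ring
  · refine (hasDerivWithinAt_phase.1 (hψ s hs)).2.1.congr_deriv ?_
    simp [langfordCore]
    ring

/-! ### The rotating frame -/

/-- Rotation by the angle `θ` about the `z`-axis. -/
noncomputable def planeRot (θ : ℝ) (p : Phase) : Phase :=
  !₂[cos θ * p 0 - sin θ * p 1, sin θ * p 0 + cos θ * p 1, p 2]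

theorem planeRot_neg_planeRot (θ : ℝ) (p : Phase) : planeRot (-θ) (planeRot θ p) = p := by
  have h := sin_sq_add_cos_sq θ
  ext i
  fin_cases i <;> simp [planeRot]
  · linear_combination p 0 * h
  · linear_combination p 1 * h

theorem dist_planeRot (θ : ℝ) (p q : Phase) : dist (planeRot θ p) (planeRot θ q) = dist p q := by
  have h := sin_sq_add_cos_sq θ
  simp only [EuclideanSpace.dist_eq, Fin.sum_univ_three, Real.dist_eq, sq_abs]
  congr 1
  simp [planeRot]
  linear_combination ((p 0 - q 0) ^ 2 + (p 1 - q 1) ^ 2) * h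

theorem planeRot_horizontal_sq (θ : ℝ) (p : Phase) :
    planeRot θ p 0 ^ 2 + planeRot θ p 1 ^ 2 = p 0 ^ 2 + p 1 ^ 2 := by
  simp [planeRot]
  linear_combination (p 0 ^ 2 + p 1 ^ 2) * sin_sq_add_cos_sq θ

theorem langfordLyap_planeRot (a e θ : ℝ) (p : Phase) :
    langfordLyap a e (planeRot θ p) = langfordLyap a e p := by
  unfold langfordLyap
  rw [planeRot_horizontal_sq]
  rfl

/-- In the frame rotating with angular velocity `b(1 + α₁) + α₃` the Langford system becomes
`langfordCore` multiplied by the scalar `1 + α₁ + α₂`. -/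
theorem HasDerivWithinAt.planeRot_langford {a b e : ℝ} {α₁ α₂ α₃ θ : ℝ → ℝ} {φ : ℝ → Phase}
    {s : Set ℝ} {t : ℝ} (hθ : HasDerivWithinAt θ (b * (1 + α₁ t) + α₃ t) s t)
    (hφ : HasDerivWithinAt φ (langfordField a b e α₁ α₂ α₃ t (φ t)) s t) :
    HasDerivWithinAt (fun t => planeRot (θ t) (φ t))
      ((1 + α₁ t + α₂ t) • langfordCore a e (planeRot (θ t) (φ t))) s t := by
  obtain ⟨h0, h1, h2⟩ := hasDerivWithinAt_phase.1 hφ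
  have h := sin_sq_add_cos_sq (θ t)
  refine hasDerivWithinAt_phase.2 ⟨?_, ?_, ?_⟩
  · refine ((hθ.cos.fun_mul h0).fun_sub (hθ.sin.fun_mul h1)).congr_deriv ?_
    simp [langfordCore, langfordField, planeRot]
    ring
  · refine ((hθ.sin.fun_mul h0).fun_add (hθ.cos.fun_mul h1)).congr_deriv ?_
    simp [langfordCore, langfordField, planeRot]
    ring
  · refine h2.congr_deriv ?_
    simp [langfordCore, langfordField, planeRot]
    linear_combination (1 + α₁ t + α₂ t) * (φ t 0 ^ 2 + φ t 1 ^ 2) * h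

/-- The converse of `HasDerivWithinAt.planeRot_langford`. -/
theorem HasDerivWithinAt.planeRot_neg_core {a b e : ℝ} {α₁ α₂ α₃ θ : ℝ → ℝ} {ψ : ℝ → Phase}
    {s : Set ℝ} {t : ℝ} (hθ : HasDerivWithinAt θ (b * (1 + α₁ t) + α₃ t) s t)
    (hψ : HasDerivWithinAt ψ ((1 + α₁ t + α₂ t) • langfordCore a e (ψ t)) s t) :
    HasDerivWithinAt (fun t => planeRot (-θ t) (ψ t))
      (langfordField a b e α₁ α₂ α₃ t (planeRot (-θ t) (ψ t))) s t := by
  obtain ⟨h0, h1, h2⟩ := hasDerivWithinAt_phase.1 hψ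
  have h := sin_sq_add_cos_sq (θ t)
  refine hasDerivWithinAt_phase.2 ⟨?_, ?_, ?_⟩
  · refine ((hθ.fun_neg.cos.fun_mul h0).fun_sub (hθ.fun_neg.sin.fun_mul h1)).congr_deriv ?_
    simp [langfordCore, langfordField, planeRot]
    ring
  · refine ((hθ.fun_neg.sin.fun_mul h0).fun_add (hθ.fun_neg.cos.fun_mul h1)).congr_deriv ?_
    simp [langfordCore, langfordField, planeRot]
    ring
  · refine h2.congr_deriv ?_
    simp [langfordCore, langfordField, planeRot]
    linear_combination (1 + α₁ t + α₂ t) * (ψ t 0 ^ 2 + ψ t 1 ^ 2) * h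

/-! ### Consequences of the periodicity of the fields -/

/-- Evaluating the field at `(1, 0, 1 - a)` isolates both combinations of the perturbations. -/
theorem periodic_of_langfordField {a b e T : ℝ} {α₁ α₂ α₃ : ℝ → ℝ}
    (h : Function.Periodic (langfordField a b e α₁ α₂ α₃) T) :
    Function.Periodic (fun t => α₁ t + α₂ t) T ∧
      Function.Periodic (fun t => b * α₁ t + α₃ t) T := by
  have hev := fun t => congrFun (h t) !₂[1, 0, 1 - a]
  refine ⟨fun t => ?_, fun t => ?_⟩
  · have := congrArg (fun p : Phase => p 0) (hev t)
    simp [langfordField] at this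
    simp only
    linarith
  · have := congrArg (fun p : Phase => p 1) (hev t)
    simp [langfordField] at this
    simp only
    linarith

/-- Evaluating the field at `(a, 0, -a)`, a point of the periodic orbit, isolates its angular
velocity. -/
theorem periodic_of_langfordField' {a b T : ℝ} {α₁ α₂ α₃ α₄ : ℝ → ℝ} (ha : a ≠ 0)
    (h : Function.Periodic (langfordField' a b α₁ α₂ α₃ α₄) T) :
    Function.Periodic (fun t => b * α₁ t + α₃ t + a ^ 4 * α₄ t) T := by
  intro t
  have := congrArg (fun p : Phase => p 1) (congrFun (h t) !₂[a, 0, -a])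
  simp [langfordField'] at this
  refine mul_left_cancel₀ ha ?_
  simp only
  linear_combination -this

/-- If the primitive of `h` is `T`-periodic and `|b| T = 2π`, the phase `b t + ∫ h` increases by
`± 2π` over a period. -/
theorem phase_add_period {b : ℝ} (hb : b ≠ 0) {H : ℝ → ℝ}
    (hH : Function.Periodic H (2 * π / |b|)) (t : ℝ) :
    b * (t + 2 * π / |b|) + H (t + 2 * π / |b|) = b * t + H t + 2 * π ∨
    b * (t + 2 * π / |b|) + H (t + 2 * π / |b|) = b * t + H t - 2 * π := by
  rw [hH t]
  rcases hb.lt_or_gt with h | h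
  · right
    rw [abs_of_neg h]
    field_simp
    ring
  · left
    rw [abs_of_pos h]
    field_simp
    ring

theorem sin_cos_phase_add_period {b : ℝ} (hb : b ≠ 0) {H : ℝ → ℝ}
    (hH : Function.Periodic H (2 * π / |b|)) (t : ℝ) :
    sin (b * (t + 2 * π / |b|) + H (t + 2 * π / |b|)) = sin (b * t + H t) ∧
    cos (b * (t + 2 * π / |b|) + H (t + 2 * π / |b|)) = cos (b * t + H t) := by
  rcases phase_add_period hb hH t with h | h <;> rw [h]
  · exact ⟨sin_add_two_pi _, cos_add_two_pi _⟩
  · exact ⟨sin_sub_two_pi _, cos_sub_two_pi _⟩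

theorem hasDerivAt_phase_angle {h : ℝ → ℝ} (hc : Continuous h) (b t : ℝ) :
    HasDerivAt (fun t => b * t + ∫ s in (0 : ℝ)..t, h s) (b + h t) t := by
  have h1 : HasDerivAt (fun t => b * t) b t := by simpa using (hasDerivAt_id' t).const_mul b
  exact h1.fun_add (hc.integral_hasStrictDerivAt 0 t).hasDerivAt

/-- A phase `b t + H t` with `b ≠ 0` and `H` continuous and bounded takes every real value. -/
theorem surjective_phase {b M : ℝ} (hb : b ≠ 0) {H : ℝ → ℝ} (hc : Continuous H)
    (hM : ∀ t, |H t| ≤ M) : Function.Surjective (fun t => b * t + H t) := by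
  have hcont : Continuous (fun t => b * t + H t) := by fun_prop
  have hlow : ∀ t, -M ≤ H t := fun t => (abs_le.1 (hM t)).1
  have hup : ∀ t, H t ≤ M := fun t => (abs_le.1 (hM t)).2
  rcases hb.lt_or_gt with h | h
  · exact hcont.surjective'
      (tendsto_atTop_add_right_of_le _ _ (tendsto_id.const_mul_atBot_of_neg h) hlow)
      (tendsto_atBot_add_right_of_ge _ _ (tendsto_id.const_mul_atTop_of_neg h) hup)
  · exact hcont.surjective
      (tendsto_atTop_add_right_of_le _ _ (tendsto_id.const_mul_atTop h) hlow)
      (tendsto_atBot_add_right_of_ge _ _ (tendsto_id.const_mul_atBot h) hup)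

/-! ### Distance to the invariant circle -/

theorem abs_apply_sub_le_dist (p q : Phase) (i : Fin 3) : |p i - q i| ≤ dist p q := by
  rw [dist_eq_norm]
  exact PiLp.norm_apply_le (p - q) i

theorem dist_le_sum_abs (p q : Phase) :
    dist p q ≤ |p 0 - q 0| + |p 1 - q 1| + |p 2 - q 2| := by
  rw [EuclideanSpace.dist_eq, Fin.sum_univ_three]
  simp only [Real.dist_eq]
  refine sqrt_le_iff.2 ⟨by positivity, ?_⟩
  nlinarith [mul_nonneg (abs_nonneg (p 0 - q 0)) (abs_nonneg (p 1 - q 1)),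
    mul_nonneg (abs_nonneg (p 0 - q 0)) (abs_nonneg (p 2 - q 2)),
    mul_nonneg (abs_nonneg (p 1 - q 1)) (abs_nonneg (p 2 - q 2))]

/-- The distance to the `z`-axis is `1`-Lipschitz. -/
theorem abs_sqrt_horizontal_sub_le_dist (p q : Phase) :
    |√(p 0 ^ 2 + p 1 ^ 2) - √(q 0 ^ 2 + q 1 ^ 2)| ≤ dist p q := by
  have hP := sq_sqrt (show 0 ≤ p 0 ^ 2 + p 1 ^ 2 by positivity)
  have hQ := sq_sqrt (show 0 ≤ q 0 ^ 2 + q 1 ^ 2 by positivity)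
  have hP0 := sqrt_nonneg (p 0 ^ 2 + p 1 ^ 2)
  have hQ0 := sqrt_nonneg (q 0 ^ 2 + q 1 ^ 2)
  refine abs_le_of_sq_le_sq ?_ dist_nonneg
  rw [EuclideanSpace.dist_sq_eq, Fin.sum_univ_three]
  simp only [Real.dist_eq, sq_abs]
  have hcs : p 0 * q 0 + p 1 * q 1 ≤ √(p 0 ^ 2 + p 1 ^ 2) * √(q 0 ^ 2 + q 1 ^ 2) := by
    refine le_of_sq_le_sq ?_ (by positivity)
    rw [mul_pow, hP, hQ]
    nlinarith [sq_nonneg (p 0 * q 1 - p 1 * q 0)]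
  nlinarith [sq_nonneg (p 2 - q 2)]

/-- The points `(r sin θ, r cos θ, -a)` with `r² = -a(a+e)` obtained from a phase `θ(t)`. -/
noncomputable def circleCurve (a e : ℝ) (θ : ℝ → ℝ) (t : ℝ) : Phase :=
  !₂[√(-a * (a + e)) * sin (θ t), √(-a * (a + e)) * cos (θ t), -a]

section Circle

variable {a e : ℝ} {θ : ℝ → ℝ}

theorem planeRot_circleCurve (t : ℝ) :
    planeRot (θ t) (circleCurve a e θ t) = !₂[0, √(-a * (a + e)), -a] := by
  ext i
  fin_cases i <;> simp [planeRot, circleCurve]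
  · ring
  · linear_combination √(-(a * (a + e))) * sin_sq_add_cos_sq (θ t)

theorem sqrt_horizontal_circleCurve (t : ℝ) :
    √(circleCurve a e θ t 0 ^ 2 + circleCurve a e θ t 1 ^ 2) = √(-a * (a + e)) := by
  rw [← sqrt_sq (sqrt_nonneg (-a * (a + e)))]
  congr 1
  simp [circleCurve]
  linear_combination √(-(a * (a + e))) ^ 2 * sin_sq_add_cos_sq (θ t)

theorem abs_radius_sub_le_dist (p : Phase) (t : ℝ) :
    |√(p 0 ^ 2 + p 1 ^ 2) - √(-a * (a + e))| ≤ dist p (circleCurve a e θ t) := by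
  rw [← sqrt_horizontal_circleCurve (θ := θ) t]
  exact abs_sqrt_horizontal_sub_le_dist _ _

theorem abs_height_add_le_dist (p : Phase) (t : ℝ) :
    |p 2 + a| ≤ dist p (circleCurve a e θ t) := by
  simpa [circleCurve] using abs_apply_sub_le_dist p (circleCurve a e θ t) 2

theorem infDist_circle_le (hθ : Function.Surjective θ) (p : Phase) :
    Metric.infDist p (range (circleCurve a e θ)) ≤
      |√(p 0 ^ 2 + p 1 ^ 2) - √(-a * (a + e))| + |p 2 + a| := by
  set w : ℂ := ⟨p 1, p 0⟩ with hw
  obtain ⟨t, ht⟩ := hθ w.arg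
  refine (Metric.infDist_le_dist_of_mem (mem_range_self t)).trans ?_
  have hn : ‖w‖ = √(p 0 ^ 2 + p 1 ^ 2) := by
    rw [Complex.norm_eq_sqrt_sq_add_sq, add_comm]
  have hcos : √(p 0 ^ 2 + p 1 ^ 2) * cos (θ t) = p 1 := by
    rw [← hn, ht, Complex.norm_mul_cos_arg]
  have hsin : √(p 0 ^ 2 + p 1 ^ 2) * sin (θ t) = p 0 := by
    rw [← hn, ht, Complex.norm_mul_sin_arg]
  set N := √(p 0 ^ 2 + p 1 ^ 2)
  set r := √(-a * (a + e)) with hr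
  rw [EuclideanSpace.dist_eq, Fin.sum_univ_three]
  simp only [Real.dist_eq, sq_abs]
  refine sqrt_le_iff.2 ⟨by positivity, ?_⟩
  have h0 : circleCurve a e θ t 0 = r * sin (θ t) := rfl
  have h1 : circleCurve a e θ t 1 = r * cos (θ t) := rfl
  have h2 : circleCurve a e θ t 2 = -a := rfl
  rw [h0, h1, h2, ← hsin, ← hcos]
  have e1 : (N * sin (θ t) - r * sin (θ t)) ^ 2 + (N * cos (θ t) - r * cos (θ t)) ^ 2
      = (N - r) ^ 2 := by
    linear_combination (N - r) ^ 2 * sin_sq_add_cos_sq (θ t)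
  rw [e1, sub_neg_eq_add]
  nlinarith [mul_nonneg (abs_nonneg (N - r)) (abs_nonneg (p 2 + a)), sq_abs (N - r),
    sq_abs (p 2 + a)]

/-- Small values of the Lyapunov function force the point to be near the circle. -/
theorem abs_radius_height_le_sqrt_lyap (h : a * (a + e) < 0) (p : Phase) :
    |√(p 0 ^ 2 + p 1 ^ 2) - √(-a * (a + e))| ≤ 2 * √(langfordLyap a e p / (-a * (a + e))) ∧
    |p 2 + a| ≤ √(langfordLyap a e p / (-a * (a + e))) := by
  have hq : 0 < -a * (a + e) := by linarith
  have hlow : (p 0 ^ 2 + p 1 ^ 2 - -a * (a + e)) ^ 2 / 2 + -a * (a + e) * (p 2 + a) ^ 2 ≤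
      langfordLyap a e p := le_lyapunovForm (2 * a + e) _ _ hq
  have hV := langfordLyap_nonneg h p
  have hρ := sq_sqrt (show 0 ≤ p 0 ^ 2 + p 1 ^ 2 by positivity)
  have hr := sq_sqrt hq.le
  have hN0 := sqrt_nonneg (p 0 ^ 2 + p 1 ^ 2)
  have hr0 := sqrt_pos.2 hq
  have hW := sq_sqrt (show 0 ≤ langfordLyap a e p / (-a * (a + e)) by positivity)
  set q := -a * (a + e)
  set V := langfordLyap a e p
  set N := √(p 0 ^ 2 + p 1 ^ 2)
  set r := √q
  constructor
  · refine abs_le_of_sq_le_sq ?_ (by positivity)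
    rw [mul_pow, hW, ← mul_div_assoc, le_div_iff₀ hq]
    rw [← hρ] at hlow
    have h1 : (N - r) ^ 2 * q ≤ (N ^ 2 - q) ^ 2 := by
      rw [← hr, show (N ^ 2 - r ^ 2) ^ 2 = (N - r) ^ 2 * (N + r) ^ 2 by ring]
      gcongr
      linarith
    nlinarith [mul_nonneg hq.le (sq_nonneg (p 2 + a))]
  · refine abs_le_sqrt ?_
    rw [le_div_iff₀ hq]
    nlinarith [sq_nonneg (p 0 ^ 2 + p 1 ^ 2 - q)]

theorem infDist_circle_le_sqrt_lyap (h : a * (a + e) < 0) (hθ : Function.Surjective θ) (p : Phase) :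
    Metric.infDist p (range (circleCurve a e θ)) ≤
      3 * √(langfordLyap a e p / (-a * (a + e))) := by
  have h1 := abs_radius_height_le_sqrt_lyap h p
  linarith [infDist_circle_le (a := a) (e := e) hθ p, h1.1, h1.2]

/-- Points near the circle have small values of the Lyapunov function. -/
theorem exists_lyap_lt_of_infDist_lt (h : a * (a + e) < 0) {ε : ℝ} (hε : 0 < ε) :
    ∃ δ > 0, ∀ p, Metric.infDist p (range (circleCurve a e θ)) < δ → langfordLyap a e p < ε := by
  have hq : 0 < -a * (a + e) := by linarith
  set q := -a * (a + e) with hqdef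
  let P : ℝ → ℝ := fun d => 3 / 2 * (d * (d + 2 * √q)) ^ 2 + 3 * q * d ^ 2
  have hP : Continuous P := by fun_prop
  have hP0 : P 0 = 0 := by simp [P]
  obtain ⟨δ, hδ, hPδ⟩ := Metric.continuousAt_iff.1 (hP.continuousAt (x := 0)) ε hε
  refine ⟨δ, hδ, fun p hp => ?_⟩
  obtain ⟨_, ⟨t, rfl⟩, ht⟩ := (Metric.infDist_lt_iff (range_nonempty _)).1 hp
  have h1 := abs_radius_sub_le_dist (a := a) (e := e) (θ := θ) p t
  have h2 := abs_height_add_le_dist (a := a) (e := e) (θ := θ) p t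
  set d := dist p (circleCurve a e θ t) with hd
  have hd0 : 0 ≤ d := dist_nonneg
  have hPd : P d < ε := by
    have := hPδ (x := d) (by simpa [abs_of_nonneg hd0] using ht)
    rw [hP0, Real.dist_eq, sub_zero] at this
    exact (le_abs_self _).trans_lt this
  refine lt_of_le_of_lt ?_ hPd
  refine (lyapunovForm_le (2 * a + e) _ _ hq).trans ?_
  have hρ := sq_sqrt (show 0 ≤ p 0 ^ 2 + p 1 ^ 2 by positivity)
  have hr := sq_sqrt hq.le
  have hN0 := sqrt_nonneg (p 0 ^ 2 + p 1 ^ 2)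
  have hr0 := sqrt_nonneg q
  rw [← hqdef] at h1 ⊢
  have h3 : (p 0 ^ 2 + p 1 ^ 2 - q) ^ 2 ≤ (d * (d + 2 * √q)) ^ 2 := by
    rw [← sq_abs]
    refine pow_le_pow_left₀ (abs_nonneg _) ?_ 2
    rw [← hρ]
    nth_rw 1 [← hr]
    rw [sq_sub_sq, abs_mul, mul_comm, abs_of_nonneg (add_nonneg hN0 hr0)]
    refine mul_le_mul h1 ?_ (by positivity) hd0
    linarith [(abs_le.1 h1).2]
  have h4 : (p 2 + a) ^ 2 ≤ d ^ 2 := by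
    rw [← sq_abs]
    exact pow_le_pow_left₀ (abs_nonneg _) h2 2
  have : 3 * q * (p 2 + a) ^ 2 ≤ 3 * q * d ^ 2 := by gcongr
  simp only [P]
  linarith

end Circle

/-! ### Stability and instability of the periodic solution -/

section Stability

variable {a b e : ℝ} {α₁ α₂ α₃ θ : ℝ → ℝ}

/-- The rotating frame turns forward solutions into integral curves of `g(t) F(ψ)`. -/
theorem IsForwardSol.planeRot {t₀ : ℝ} {p : Phase} {φ : ℝ → Phase}
    (hθ : ∀ t, HasDerivAt θ (b * (1 + α₁ t) + α₃ t) t)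
    (hφ : IsForwardSol (langfordField a b e α₁ α₂ α₃) t₀ p φ) :
    IsIntegralCurveOn (fun t => planeRot (θ t) (φ t))
      (fun t p => (1 + α₁ t + α₂ t) • langfordCore a e p) (Ici t₀) := fun t ht =>
  (hθ t).hasDerivWithinAt.planeRot_langford (hφ.2 t ht)

theorem isIntegralCurve_circleCurve (h : a * (a + e) < 0)
    (hθ : ∀ t, HasDerivAt θ (b * (1 + α₁ t) + α₃ t) t) :
    IsIntegralCurve (circleCurve a e θ) (langfordField a b e α₁ α₂ α₃) := by
  intro t
  have hcirc : circleCurve a e θ =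
      fun t => planeRot (-θ t) !₂[0, √(-a * (a + e)), -a] := by
    funext t
    rw [← planeRot_circleCurve (θ := θ) t, planeRot_neg_planeRot]
  have hzero : langfordCore a e !₂[0, √(-a * (a + e)), -a] = 0 := by
    have hr := sq_sqrt (show 0 ≤ -a * (a + e) by linarith)
    ext i
    fin_cases i <;> simp [langfordCore]
    simp only [neg_mul] at hr
    linarith
  rw [hcirc, ← hasDerivWithinAt_univ]
  refine (hθ t).hasDerivWithinAt.planeRot_neg_core ?_
  simp only [hzero, smul_zero]
  exact hasDerivWithinAt_const _ _ _

/-- Every solution starting near the circle exists for all forward times, and its Lyapunov function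
is controlled by its initial value and by the time change `τ`. -/
theorem langford_forward_estimate (h : a * (a + e) < 0) (hc : 2 * a + e < 0)
    (hg : Continuous fun t => 1 + α₁ t + α₂ t)
    (hθ : ∀ t, HasDerivAt θ (b * (1 + α₁ t) + α₃ t) t) {τ : ℝ → ℝ} {t₀ M : ℝ}
    (hτ : ∀ t, HasDerivAt τ (1 + α₁ t + α₂ t) t) (hτ₀ : τ t₀ = 0) (hM : 0 ≤ M)
    (hτM : ∀ t ≥ t₀, -M ≤ τ t) :
    ∃ D₀ > 0, ∃ C > 0, ∃ κ > 0, ∀ (p : Phase) (D : ℝ), 0 < D → D < D₀ →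
      langfordLyap a e p ≤ D →
      (∃ φ, IsForwardSol (langfordField a b e α₁ α₂ α₃) t₀ p φ) ∧
      ∀ φ, IsForwardSol (langfordField a b e α₁ α₂ α₃) t₀ p φ → ∀ t ≥ t₀,
        0 < φ t 0 ^ 2 + φ t 1 ^ 2 ∧ langfordLyap a e (φ t) ≤ C * D * exp (-κ * τ t) ∧
        langfordLyap a e (φ t) ≤ C * exp (κ * M) * D := by
  obtain ⟨D₀, hD₀, C, hC, κ, hκ, hst⟩ := langfordCore_stable_timeChange h hc hg hτ hτ₀ hM hτM
  refine ⟨D₀, hD₀, C, hC, κ, hκ, fun p D hD hDD hp => ?_⟩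
  obtain ⟨⟨ψ, hψ0, hψ⟩, hall⟩ := hst (planeRot (θ t₀) p) D hD hDD
    (by rwa [langfordLyap_planeRot])
  refine ⟨⟨fun t => planeRot (-θ t) (ψ t), ?_, fun t ht => ?_⟩, fun φ hφ t ht => ?_⟩
  · simp only [hψ0, planeRot_neg_planeRot]
  · exact (hθ t).hasDerivWithinAt.planeRot_neg_core (hψ t ht)
  · obtain ⟨h1, h2⟩ := hall _ (by simp only [hφ.1]) (hφ.planeRot hθ) t ht
    rw [planeRot_horizontal_sq] at h1
    rw [langfordLyap_planeRot] at h2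
    refine ⟨h1, h2, h2.trans ?_⟩
    rw [mul_right_comm]
    have hexp : exp (-κ * τ t) ≤ exp (κ * M) := exp_le_exp.2 (by nlinarith [hτM t ht])
    gcongr

/-- The direction of the horizontal part is constant in the rotating frame, so that the distance
between a solution and the periodic solution at equal times is controlled by its initial value
and by the Lyapunov function. -/
theorem dist_circleCurve_le (h : a * (a + e) < 0)
    (hθ : ∀ t, HasDerivAt θ (b * (1 + α₁ t) + α₃ t) t) {t₀ : ℝ} {p : Phase} {φ : ℝ → Phase}
    (hφ : IsForwardSol (langfordField a b e α₁ α₂ α₃) t₀ p φ)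
    (hpos : ∀ t ≥ t₀, 0 < φ t 0 ^ 2 + φ t 1 ^ 2) {t : ℝ} (ht : t₀ ≤ t) :
    dist (φ t) (circleCurve a e θ t) ≤ 4 * dist p (circleCurve a e θ t₀) +
      5 * √(langfordLyap a e (φ t) / (-a * (a + e))) := by
  have hdir := langfordCore_direction (hφ.planeRot hθ)
    (fun t ht => by rw [planeRot_horizontal_sq]; exact hpos t ht) ht
  simp only [planeRot_horizontal_sq, hφ.1] at hdir
  have hp0 : 0 < √(p 0 ^ 2 + p 1 ^ 2) := sqrt_pos.2 (by simpa only [hφ.1] using hpos t₀ le_rfl)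
  obtain ⟨hN, hz⟩ := abs_radius_height_le_sqrt_lyap h (φ t)
  have hN₀ := abs_radius_sub_le_dist (a := a) (e := e) (θ := θ) p t₀
  have hd := dist_planeRot (θ t₀) p (circleCurve a e θ t₀)
  rw [← dist_planeRot (θ t) (φ t), planeRot_circleCurve]
  rw [planeRot_circleCurve] at hd
  have hu₀ := abs_apply_sub_le_dist (planeRot (θ t₀) p) !₂[0, √(-a * (a + e)), -a] 0
  have hv₀ := abs_apply_sub_le_dist (planeRot (θ t₀) p) !₂[0, √(-a * (a + e)), -a] 1
  rw [hd] at hu₀ hv₀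
  refine (dist_le_sum_abs _ _).trans ?_
  have hz' : |planeRot (θ t) (φ t) 2 - (!₂[0, √(-a * (a + e)), -a] : Phase) 2| = |φ t 2 + a| := by
    simp [planeRot]
  rw [hz']
  have hP := planeRot_horizontal_sq (θ t₀) p
  set P := planeRot (θ t₀) p
  set Q := planeRot (θ t) (φ t)
  set N₀ := √(p 0 ^ 2 + p 1 ^ 2) with hN₀def
  set N := √(φ t 0 ^ 2 + φ t 1 ^ 2)
  set r := √(-a * (a + e))
  set d := dist p (circleCurve a e θ t₀)
  set W := √(langfordLyap a e (φ t) / (-a * (a + e)))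
  have hNN : |N - N₀| ≤ 2 * W + d := by
    rw [abs_le] at hN hN₀ ⊢
    constructor <;> linarith [hN.1, hN.2, hN₀.1, hN₀.2]
  -- a horizontal coordinate changes by at most the change of the distance to the axis
  have hcoord : ∀ x y : ℝ, N₀ * y = N * x → x ^ 2 ≤ p 0 ^ 2 + p 1 ^ 2 → |y - x| ≤ |N - N₀| := by
    intro x y hxy hx
    have h1 : |x| ≤ N₀ := abs_le_sqrt hx
    have h2 : N₀ * |y - x| = |N - N₀| * |x| := by
      rw [← abs_mul, ← abs_of_pos hp0, ← abs_mul, abs_of_pos hp0]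
      congr 1
      linear_combination hxy
    refine le_of_mul_le_mul_left ?_ hp0
    rw [h2, mul_comm N₀]
    gcongr
  have hu := hcoord _ _ hdir.1 (by nlinarith [sq_nonneg (P 1)])
  have hv := hcoord _ _ hdir.2 (by nlinarith [sq_nonneg (P 0)])
  have hu' := abs_sub_le (Q 0) (P 0) ((!₂[0, r, -a] : Phase) 0)
  have hv' := abs_sub_le (Q 1) (P 1) ((!₂[0, r, -a] : Phase) 1)
  linarith

theorem exists_pos_forall_sqrt_div_le {q C D₀ ε : ℝ} (hq : 0 < q) (hC : 0 < C) (hD₀ : 0 < D₀)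
    (hε : 0 < ε) : ∃ D, 0 < D ∧ D < D₀ ∧ ∀ V ≤ C * D, √(V / q) ≤ ε := by
  refine ⟨min (D₀ / 2) (ε ^ 2 * q / C), by positivity, (min_le_left _ _).trans_lt (by linarith),
    fun V hV => sqrt_le_iff.2 ⟨hε.le, ?_⟩⟩
  rw [div_le_iff₀ hq]
  refine hV.trans ((mul_le_mul_of_nonneg_left (min_le_right _ _) hC.le).trans_eq ?_)
  field_simp

theorem orbitallyAsympStableAt_circleCurve (h : a * (a + e) < 0) (hc : 2 * a + e < 0)
    (hg : Continuous fun t => 1 + α₁ t + α₂ t)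
    (hθ : ∀ t, HasDerivAt θ (b * (1 + α₁ t) + α₃ t) t) (hsurj : Function.Surjective θ)
    {τ : ℝ → ℝ} {t₀ M : ℝ} (hτ : ∀ t, HasDerivAt τ (1 + α₁ t + α₂ t) t) (hτ₀ : τ t₀ = 0)
    (hM : 0 ≤ M) (hτM : ∀ t ≥ t₀, -M ≤ τ t) (hτtop : Tendsto τ atTop atTop) :
    OrbitallyAsympStableAt (langfordField a b e α₁ α₂ α₃) (circleCurve a e θ) t₀ := by
  have hq : 0 < -a * (a + e) := by linarith
  obtain ⟨D₀, hD₀, C, hC, κ, hκ, hest⟩ :=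
    langford_forward_estimate (b := b) (α₃ := α₃) h hc hg hθ hτ hτ₀ hM hτM
  refine ⟨fun ε hε => ?_, ?_⟩
  · obtain ⟨D, hD, hDD, hDε⟩ := exists_pos_forall_sqrt_div_le hq
      (show 0 < C * exp (κ * M) by positivity) hD₀ (show 0 < ε / 4 by positivity)
    obtain ⟨δ, hδ, hδD⟩ := exists_lyap_lt_of_infDist_lt (θ := θ) h hD
    refine ⟨δ, hδ, fun p hp => ?_⟩
    obtain ⟨hex, hall⟩ := hest p D hD hDD (hδD p hp).le
    refine ⟨hex, fun φ hφ t ht => ?_⟩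
    have h1 := hDε _ (hall φ hφ t ht).2.2
    linarith [infDist_circle_le_sqrt_lyap h hsurj (φ t)]
  · obtain ⟨δ, hδ, hδD⟩ := exists_lyap_lt_of_infDist_lt (θ := θ) h (half_pos hD₀)
    refine ⟨δ, hδ, fun p hp φ hφ => ?_⟩
    have hall := (hest p (D₀ / 2) (half_pos hD₀) (by linarith) (hδD p hp).le).2 φ hφ
    have hexp : Tendsto (fun t => exp (-κ * τ t)) atTop (𝓝 0) :=
      tendsto_exp_atBot.comp (hτtop.const_mul_atTop_of_neg (by linarith))
    have hlim : Tendsto (fun t => 3 * √(C * (D₀ / 2) * exp (-κ * τ t) / (-a * (a + e)))) atTop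
        (𝓝 0) := by
      have := (((hexp.const_mul (C * (D₀ / 2))).div_const (-a * (a + e))).sqrt).const_mul 3
      simpa using this
    refine squeeze_zero' (Eventually.of_forall fun t => Metric.infDist_nonneg) ?_ hlim
    filter_upwards [eventually_ge_atTop t₀] with t ht
    refine (infDist_circle_le_sqrt_lyap h hsurj (φ t)).trans ?_
    gcongr
    exact (hall t ht).2.1

theorem lyapunovStableAt_circleCurve (h : a * (a + e) < 0) (hc : 2 * a + e < 0)
    (hg : Continuous fun t => 1 + α₁ t + α₂ t)
    (hθ : ∀ t, HasDerivAt θ (b * (1 + α₁ t) + α₃ t) t)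
    {τ : ℝ → ℝ} {t₀ M : ℝ} (hτ : ∀ t, HasDerivAt τ (1 + α₁ t + α₂ t) t) (hτ₀ : τ t₀ = 0)
    (hM : 0 ≤ M) (hτM : ∀ t ≥ t₀, -M ≤ τ t) :
    LyapunovStableAt (langfordField a b e α₁ α₂ α₃) (circleCurve a e θ) t₀ := by
  have hq : 0 < -a * (a + e) := by linarith
  obtain ⟨D₀, hD₀, C, hC, κ, hκ, hest⟩ :=
    langford_forward_estimate (b := b) (α₃ := α₃) h hc hg hθ hτ hτ₀ hM hτM
  intro ε hε
  obtain ⟨D, hD, hDD, hDε⟩ := exists_pos_forall_sqrt_div_le hq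
    (show 0 < C * exp (κ * M) by positivity) hD₀ (show 0 < ε / 10 by positivity)
  obtain ⟨δ, hδ, hδD⟩ := exists_lyap_lt_of_infDist_lt (θ := θ) h hD
  refine ⟨min δ (ε / 8), by positivity, fun p hp => ?_⟩
  have hinf : Metric.infDist p (range (circleCurve a e θ)) < δ :=
    (Metric.infDist_le_dist_of_mem (mem_range_self t₀)).trans_lt (hp.trans_le (min_le_left _ _))
  obtain ⟨hex, hall⟩ := hest p D hD hDD (hδD p hinf).le
  refine ⟨hex, fun φ hφ t ht => ?_⟩
  have h1 := hDε _ (hall φ hφ t ht).2.2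
  have h2 := dist_circleCurve_le h hθ hφ (fun t ht => (hall φ hφ t ht).1) ht
  linarith [hp.trans_le (min_le_right δ (ε / 8))]

/-- For `2a + e > 0` solutions that start at `χ(t₀) + (0, 0, d)` with `d > 0` arbitrarily small leave
a fixed neighbourhood of the circle. -/
theorem exists_neighbourhood_left (h : a * (a + e) < 0) (hc : 0 < 2 * a + e)
    (hg : Continuous fun t => 1 + α₁ t + α₂ t)
    (hθ : ∀ t, HasDerivAt θ (b * (1 + α₁ t) + α₃ t) t)
    {τ : ℝ → ℝ} {t₀ : ℝ} (hτ : ∀ t, HasDerivAt τ (1 + α₁ t + α₂ t) t) (hτ₀ : τ t₀ = 0)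
    (hτtop : Tendsto τ atTop atTop) :
    ∃ ε > 0, ∀ δ > 0, ∃ p, dist p (circleCurve a e θ t₀) < δ ∧
      ∀ φ, IsForwardSol (langfordField a b e α₁ α₂ α₃) t₀ p φ →
        ¬ ∀ t ≥ t₀, Metric.infDist (φ t) (range (circleCurve a e θ)) < ε := by
  have hq : 0 < -a * (a + e) := by linarith
  obtain ⟨r, hr, hun⟩ := langfordCore_unstable h hc
  obtain ⟨ε, hε, hεr⟩ := exists_lyap_lt_of_infDist_lt (θ := θ) h hr
  refine ⟨ε, hε, fun δ hδ => ⟨circleCurve a e θ t₀ + !₂[0, 0, δ / 2], ?_, fun φ hφ hlt => ?_⟩⟩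
  · refine (dist_le_sum_abs _ _).trans_lt ?_
    simp [abs_of_pos (half_pos hδ), hδ]
  · refine hun _ τ t₀ _ hg hτ hτ₀ hτtop (hφ.planeRot hθ) ?_ fun t ht => ?_
    · rw [langfordLyap_planeRot, hφ.1]
      refine lt_of_lt_of_le ?_ (le_lyapunovForm _ _ _ hq)
      have : (circleCurve a e θ t₀ + !₂[0, 0, δ / 2]) 2 + a = δ / 2 := by
        simp [circleCurve]
      rw [this]
      positivity
    · rw [langfordLyap_planeRot]
      exact hεr _ (hlt t ht)

/-- Solutions that start arbitrarily near `χ(t₀)` and leave a fixed neighbourhood of the orbit refute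
both kinds of stability, since the distance to the orbit is at most the distance to `χ(t)`. -/
theorem not_stable_of_left {f : ℝ → Phase → Phase} {χ : ℝ → Phase} {t₀ : ℝ}
    (hleft : ∃ ε > 0, ∀ δ > 0, ∃ p, dist p (χ t₀) < δ ∧ ∀ φ, IsForwardSol f t₀ p φ →
      ¬ ∀ t ≥ t₀, Metric.infDist (φ t) (range χ) < ε) :
    ¬ OrbitallyStableAt f χ t₀ ∧ ¬ LyapunovStableAt f χ t₀ := by
  obtain ⟨ε, hε, hleft⟩ := hleft
  constructor
  · intro hst
    obtain ⟨δ, hδ, hall⟩ := hst ε hε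
    obtain ⟨p, hp, hφ⟩ := hleft δ hδ
    obtain ⟨⟨φ, hφs⟩, hall⟩ := hall p
      ((Metric.infDist_le_dist_of_mem (mem_range_self t₀)).trans_lt hp)
    exact hφ φ hφs (hall φ hφs)
  · intro hst
    obtain ⟨δ, hδ, hall⟩ := hst ε hε
    obtain ⟨p, hp, hφ⟩ := hleft δ hδ
    obtain ⟨⟨φ, hφs⟩, hall⟩ := hall p hp
    exact hφ φ hφs fun t ht =>
      (Metric.infDist_le_dist_of_mem (mem_range_self t)).trans_lt (hall φ hφs t ht)

end Stability

/-! ### The time change -/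

/-- The time change `τ(t) = ∫ (1 + h)` with `h` odd and periodic differs from `t` by a bounded
function. -/
theorem exists_timeChange {h : ℝ → ℝ} {T : ℝ} (hT : T ≠ 0) (hc : Continuous h)
    (ho : Function.Odd h) (hp : Function.Periodic h T) (t₀ : ℝ) :
    ∃ τ : ℝ → ℝ, ∃ M ≥ 0, (∀ t, HasDerivAt τ (1 + h t) t) ∧ τ t₀ = 0 ∧
      (∀ t ≥ t₀, -M ≤ τ t) ∧ Tendsto τ atTop atTop := by
  obtain ⟨M, hM⟩ := hp.exists_abs_integral_le_of_odd hT hc ho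
  have hM0 : 0 ≤ M := (abs_nonneg _).trans (hM 0)
  set H : ℝ → ℝ := fun t => ∫ s in (0 : ℝ)..t, h s with hH
  have hlow : ∀ t, t - t₀ - 2 * M ≤ 1 * t + H t - (1 * t₀ + H t₀) := fun t => by
    linarith [(abs_le.1 (hM t)).1, (abs_le.1 (hM t₀)).2]
  refine ⟨fun t => 1 * t + H t - (1 * t₀ + H t₀), 2 * M, by positivity,
    fun t => (hasDerivAt_phase_angle hc 1 t).sub_const _, sub_self _, fun t ht => ?_, ?_⟩
  · linarith [hlow t]
  · refine tendsto_atTop_mono hlow ?_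
    simp only [sub_eq_add_neg]
    exact tendsto_atTop_add_const_right _ _ (tendsto_atTop_add_const_right _ _ tendsto_id)

/-! ### The system with a fourth perturbation -/

/-- On the circle `x² + y² = a²`, `z = -a` the term with `α₄` is a rotation with angular velocity
`a⁴ α₄`. -/
theorem isIntegralCurve_langfordSol' (a b : ℝ) {α₁ α₂ α₃ α₄ : ℝ → ℝ} (h₁ : Continuous α₁)
    (h₃ : Continuous α₃) (h₄ : Continuous α₄) :
    IsIntegralCurve (langfordSol' a b α₁ α₃ α₄) (langfordField' a b α₁ α₂ α₃ α₄) := by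
  intro t
  have hη := hasDerivAt_phase_angle (h := fun s => b * α₁ s + α₃ s + a ^ 4 * α₄ s)
    (by fun_prop) b t
  set η : ℝ → ℝ := fun t => b * t + ∫ s in (0 : ℝ)..t, (b * α₁ s + α₃ s + a ^ 4 * α₄ s) with hηdef
  have hsol : langfordSol' a b α₁ α₃ α₄ = fun t => !₂[a * sin (η t), a * cos (η t), -a] := rfl
  -- on the circle `x² + y² = a²` the errors are multiples of `x² + y² - a²`
  have hS : (a * sin (η t)) ^ 2 + (a * cos (η t)) ^ 2 = a ^ 2 := by
    linear_combination a ^ 2 * sin_sq_add_cos_sq (η t)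
  rw [hsol]
  refine hasDerivAt_phase.2 ⟨?_, ?_, ?_⟩
  · refine (hη.sin.const_mul a).congr_deriv ?_
    simp [langfordField']
    linear_combination (a * cos (η t) * α₄ t *
      ((a * sin (η t)) ^ 2 + (a * cos (η t)) ^ 2 - a ^ 2)) * hS
  · refine (hη.cos.const_mul a).congr_deriv ?_
    simp [langfordField']
    linear_combination (-(a * sin (η t) * α₄ t *
      ((a * sin (η t)) ^ 2 + (a * cos (η t)) ^ 2 - a ^ 2))) * hS
  · refine (hasDerivAt_const t (-a)).congr_deriv ?_
    simp [langfordField']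
    exact Or.inl (by linear_combination -hS)

theorem theorem4 (a b : ℝ) (hb : b ≠ 0) (α₁ α₂ α₃ α₄ : ℝ → ℝ)
    (hα₁ : ContDiff ℝ 2 α₁) (hα₂ : ContDiff ℝ 2 α₂)
    (hα₃ : ContDiff ℝ 2 α₃) (hα₄ : ContDiff ℝ 2 α₄)
    (hodd₁ : Function.Odd α₁) (hodd₂ : Function.Odd α₂)
    (hodd₃ : Function.Odd α₃) (hodd₄ : Function.Odd α₄) :
    (∀ e : ℝ,
      Function.Periodic (langfordField a b e α₁ α₂ α₃) (2 * π / |b|) →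
      a * (a + e) < 0 →
      (∃ k : ℤ, ∫ s in (0 : ℝ)..(-2 * π / |b|), (b * α₁ s + α₃ s) = 2 * π * k) →
        IsIntegralCurve (langfordSol a b e α₁ α₃) (langfordField a b e α₁ α₂ α₃) ∧
        Function.Periodic (langfordSol a b e α₁ α₃) (2 * π / |b|) ∧
        (2 * a + e < 0 → ∀ t₀ : ℝ,
          OrbitallyAsympStableAt (langfordField a b e α₁ α₂ α₃) (langfordSol a b e α₁ α₃) t₀ ∧
          LyapunovStableAt (langfordField a b e α₁ α₂ α₃) (langfordSol a b e α₁ α₃) t₀) ∧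
        (0 < 2 * a + e → ∀ t₀ : ℝ,
          ¬ OrbitallyStableAt (langfordField a b e α₁ α₂ α₃) (langfordSol a b e α₁ α₃) t₀ ∧
          ¬ LyapunovStableAt (langfordField a b e α₁ α₂ α₃) (langfordSol a b e α₁ α₃) t₀)) ∧
    (Function.Periodic (langfordField' a b α₁ α₂ α₃ α₄) (2 * π / |b|) →
      (∃ k : ℤ, ∫ s in (0 : ℝ)..(-2 * π / |b|),
        (b * α₁ s + α₃ s + a ^ 4 * α₄ s) = 2 * π * k) →
        IsIntegralCurve (langfordSol' a b α₁ α₃ α₄) (langfordField' a b α₁ α₂ α₃ α₄) ∧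
        Function.Periodic (langfordSol' a b α₁ α₃ α₄) (2 * π / |b|)) := by
  have hc₁ := hα₁.continuous
  have hc₂ := hα₂.continuous
  have hc₃ := hα₃.continuous
  have hc₄ := hα₄.continuous
  have hT : 2 * π / |b| ≠ 0 := by positivity
  constructor
  · intro e hper h _
    obtain ⟨hp₁₂, hp₁₃⟩ := periodic_of_langfordField hper
    have ho₁₂ : Function.Odd (fun t => α₁ t + α₂ t) := fun t => by
      simp only [hodd₁ t, hodd₂ t]; ring
    have ho₁₃ : Function.Odd (fun t => b * α₁ t + α₃ t) := fun t => by
      simp only [hodd₁ t, hodd₃ t]; ring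
    have hcont₁₃ : Continuous (fun t => b * α₁ t + α₃ t) := by fun_prop
    set θ : ℝ → ℝ := fun t => b * t + ∫ s in (0 : ℝ)..t, (b * α₁ s + α₃ s) with hθdef
    have hsol : langfordSol a b e α₁ α₃ = circleCurve a e θ := rfl
    have hθ : ∀ t, HasDerivAt θ (b * (1 + α₁ t) + α₃ t) t := fun t =>
      (hasDerivAt_phase_angle hcont₁₃ b t).congr_deriv (by ring)
    obtain ⟨M', hM'⟩ := hp₁₃.exists_abs_integral_le_of_odd hT hcont₁₃ ho₁₃
    have hsurj : Function.Surjective θ := surjective_phase hb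
      (intervalIntegral.continuous_primitive (fun u v => hcont₁₃.intervalIntegrable u v) 0) hM'
    have hg : Continuous (fun t => 1 + α₁ t + α₂ t) := by fun_prop
    have htime := exists_timeChange hT (hc₁.add hc₂) ho₁₂ hp₁₂
    simp only [Pi.add_apply, ← add_assoc] at htime
    rw [hsol]
    refine ⟨isIntegralCurve_circleCurve h hθ, fun t => ?_, fun hc t₀ => ?_, fun hc t₀ => ?_⟩
    · obtain ⟨hs, hco⟩ := sin_cos_phase_add_period hb (hp₁₃.integral_of_odd hcont₁₃ ho₁₃) t
      simp only [circleCurve, hθdef, hs, hco]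
    · obtain ⟨τ, M, hM, hτ, hτ₀, hτM, hτtop⟩ := htime t₀
      exact ⟨orbitallyAsympStableAt_circleCurve h hc hg hθ hsurj hτ hτ₀ hM hτM hτtop,
        lyapunovStableAt_circleCurve h hc hg hθ hτ hτ₀ hM hτM⟩
    · obtain ⟨τ, M, hM, hτ, hτ₀, hτM, hτtop⟩ := htime t₀
      exact not_stable_of_left (exists_neighbourhood_left h hc hg hθ hτ hτ₀ hτtop)
  · intro hper _
    refine ⟨isIntegralCurve_langfordSol' a b hc₁ hc₃ hc₄, fun t => ?_⟩
    rcases eq_or_ne a 0 with rfl | ha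
    · simp [langfordSol']
    · have hodd : Function.Odd (fun t => b * α₁ t + α₃ t + a ^ 4 * α₄ t) := fun t => by
        simp only [hodd₁ t, hodd₃ t, hodd₄ t]; ring
      obtain ⟨hs, hco⟩ := sin_cos_phase_add_period hb
        ((periodic_of_langfordField' ha hper).integral_of_odd (by fun_prop) hodd) t
      simp only [langfordSol', hs, hco]
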